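/- Let $k,p,n,T\ge 1$ be integers with $T\mid n$. Let $\beta_1,\dots,\beta_k\in\mathbb{R}^p$ be linearly independent, and let $\omega_1,\dots,\omega_k>0$ with $\sum_j\omega_j=1$. Let $(y_i,x_i)$, $i=1,\dots,n$, be samples of mixed linear equations: $x_i\sim\mathcal N(0,I_p)$, the label $z_i\in\{1,\dots,k\}$ is independent of $x_i$ with $\mathbb P[z_i=j]=\omega_j$, the pairs $(x_i,z_i)$ are independent, and $y_i=\langle x_i,\beta_{z_i}\rangle$; the labels are not observed. Put $\underline\omega=\min_j\omega_j$, $\Delta=\min_{i\ne j}\|\beta_i-\beta_j\|_2$ (with $\Delta=\infty$ if $k=1$), and, for estimates $\{\hat\beta_j\}_{j=1}^k$, $$\mathcal E(\{\hat\beta_j\})=\inf_{\pi}\max_{j}\|\hat\beta_j-\beta_{\pi(j)}\|_2,$$ where $\pi$ ranges over the permutations of $\{1,\dots,k\}$. Alternating minimization with resampling starts at given (deterministic) estimates $\{\beta_j^{(0)}\}$ and splits the samples, independently of their values, into $T$ disjoint batches $\{(y_i^{(t)},x_i^{(t)})\}_{i=1}^{n/T}$, $t=0,\dots,T-1$, of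 equal size. Iteration $t=0,\dots,T-1$ computes $$\hat z_i^{(t)}\in\arg\min_{j}\bigl|y_i^{(t)}-\langle x_i^{(t)},\beta_j^{(t)}\rangle\bigr|\ \ (1\le i\le n/T),\qquad \beta_j^{(t+1)}\in\arg\min_{\beta\in\mathbb R^p}\sum_{i=1}^{n/T}\bigl(y_i^{(t)}-\langle x_i^{(t)},\beta\rangle\bigr)^2\mathbf 1(\hat z_i^{(t)}=j)\ \ (1\le j\le k),$$ where minimizers that are not unique are chosen in any way that makes $\{\beta_j^{(t+1)}\}$ a measurable function of the samples of the batches $0,\dots,t$. Let $\varepsilon_0=\mathcal E(\{\beta_j^{(0)}\})$. There are absolute constants $C_1,C_2>0$ such that the following holds for all such data and all $\delta\in(0,1)$. If $$\varepsilon_0\le C_1\Bigl(\frac1{k^2}\wedge\underline\omega\Bigr)\Delta,\qquad p\ge\log(2k^2T/\delta),\qquad \frac nT\ge C_2\Bigl(\frac{kp}{\underline\omega}\vee\frac{\log(8k^2T/\delta)}{\underline\omega^2}\Bigr),$$ then with probability at least $1-\delta$ $$\mathcal E(\{\beta_j^{(t)}\})\le 2^{-t}\varepsilon_0\quad\text{for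 all }t=1,\dots,T.$$ -/

import Mathlib

open MeasureTheory ProbabilityTheory
open scoped ENNReal

namespace MixedLinear

/-- `ℝ^p` with the Euclidean norm and inner product. -/
abbrev Vec (p : ℕ) : Type := EuclideanSpace ℝ (Fin p)

/-- The estimation error of the estimates `b` for the parameters `β`: the infimum over all
permutations `π` of `sup_j ‖b_j - β_{π(j)}‖`. -/
noncomputable def estimationError {k p : ℕ} (b β : Fin k → Vec p) : ℝ :=
  ⨅ π : Equiv.Perm (Fin k), ⨆ j : Fin k, ‖b j - β (π j)‖

/-- The minimum distance `Δ` between two parameters with different indices. It is a real number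
when there are at least two parameters; with a single one there is no pair, and it is `∞`. -/
noncomputable def separation {k p : ℕ} (β : Fin k → Vec p) : ℝ≥0∞ :=
  ⨅ (i : Fin k) (j : Fin k) (_ : i ≠ j), edist (β i) (β j)

/-- The smallest mixture weight. -/
noncomputable def minWeight {k : ℕ} (w : Fin k → ℝ) : ℝ := ⨅ j : Fin k, w j

/-- `n` samples `(y_i, x_i)` of noiseless mixed linear equations with parameters `β` and
weights `w`: the pairs (covariate `x_i`, latent label `c_i`) are independent, `x_i` is standard
Gaussian and independent of `c_i`, the label `c_i` is `j` with probability `w_j`, and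
`y_i = ∑_j ⟨x_i, β_j⟩ 1(c_i = j)`. -/
structure IsMixedLinearSample {Ω : Type*} [MeasurableSpace Ω] (μ : Measure Ω) {k p n : ℕ}
    (w : Fin k → ℝ) (β : Fin k → Vec p)
    (x : Fin n → Ω → Vec p) (c : Fin n → Ω → Fin k) (y : Fin n → Ω → ℝ) : Prop where
  measurable_covariate : ∀ i, Measurable (x i)
  measurable_label : ∀ i, Measurable (c i)
  law_covariate : ∀ i, μ.map (x i) = stdGaussian (Vec p)
  law_label : ∀ i j, μ {ω | c i ω = j} = ENNReal.ofReal (w j)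
  indep_covariate_label : ∀ i, IndepFun (x i) (c i) μ
  indep_samples : iIndepFun (fun i ω => (x i ω, c i ω)) μ
  response : ∀ i ω, y i ω = ∑ j : Fin k, inner ℝ (x i ω) (β j) * (if c i ω = j then 1 else 0)

/-- The labels `z` are a valid label assignment for the estimates `b` on a batch `(x, y)`:
`z_i ∈ argmin_j |y_i - ⟨x_i, b_j⟩|` (ties are broken in any way). -/
def IsLabelAssignment {k p B : ℕ} (x : Fin B → Vec p) (y : Fin B → ℝ) (b : Fin k → Vec p)
    (z : Fin B → Fin k) : Prop :=
  ∀ (i : Fin B) (j : Fin k),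
    |y i - inner ℝ (x i) (b (z i))| ≤ |y i - inner ℝ (x i) (b j)|

/-- The least-squares loss of the vector `v` over the samples of a batch that have label `j`. -/
noncomputable def labelLoss {k p B : ℕ} (x : Fin B → Vec p) (y : Fin B → ℝ) (z : Fin B → Fin k)
    (j : Fin k) (v : Vec p) : ℝ :=
  ∑ i : Fin B, (y i - inner ℝ (x i) v) ^ 2 * (if z i = j then 1 else 0)

/-- The estimates `b'` are a valid parameter update for the labels `z` on a batch `(x, y)`:
each `b'_j` minimizes the least-squares loss over the samples that have label `j`. -/
def IsParameterUpdate {k p B : ℕ} (x : Fin B → Vec p) (y : Fin B → ℝ) (z : Fin B → Fin k)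
    (b' : Fin k → Vec p) : Prop :=
  ∀ (j : Fin k) (v : Vec p), labelLoss x y z j (b' j) ≤ labelLoss x y z j v

/-- `b 0, …, b T` are iterates of alternating minimization with resampling on the `n` samples
`(x_i, y_i)`, which `e` splits into `T` disjoint batches of equal size `B`, with the initial
estimates `b₀`. Iteration `t` uses the batch `t` only. The minimizers need not be unique, and they
may be chosen in any way that makes `b t` a measurable function of the samples of the
batches `0, …, t - 1`. -/
structure IsResampledAltMin {Ω : Type*} {k p n T B : ℕ}
    (x : Fin n → Ω → Vec p) (y : Fin n → Ω → ℝ) (e : Fin T × Fin B ≃ Fin n)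
    (b₀ : Fin k → Vec p) (b : ℕ → Ω → Fin k → Vec p) : Prop where
  init : ∀ ω, b 0 ω = b₀
  step : ∀ (t : Fin T) (ω : Ω), ∃ z : Fin B → Fin k,
    IsLabelAssignment (fun i => x (e (t, i)) ω) (fun i => y (e (t, i)) ω) (b t ω) z ∧
    IsParameterUpdate (fun i => x (e (t, i)) ω) (fun i => y (e (t, i)) ω) z (b (t + 1) ω)
  adapted : ∀ t : ℕ, t ≤ T →
    ∃ g : ({s : Fin T // (s : ℕ) < t} × Fin B → Vec p × ℝ) → Fin k → Vec p,
      Measurable g ∧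
      ∀ ω, b t ω = g (fun q => (x (e (q.1.1, q.2)) ω, y (e (q.1.1, q.2)) ω))

end MixedLinear

namespace MixedLinear

/-! Relabel the estimates once, so that `b l` is within `ε` of `β l` for every `l`. A sample with
true label `l` can receive the label `j` only if `|⟨x, β l - β j⟩|` is at most `|⟨x, b l - β l⟩| +
|⟨x, b j - β j⟩|`. For Gaussian `x` this has probability `O(ρ)` when `ε ≤ ρ ‖β l - β j‖`, and the
right-hand side stays of order `ε` there, with sub-Gaussian tails (`setLIntegral_exp_inner_sq_le`).

Put `W = B * w j`. The update `b' j` has at most the loss of `β j`. There is no noise, so only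
mislabelled samples contribute to the loss at `β j`, and their total is at most `W ε² / 256`. The
samples of label `j` that cannot be confused contribute at least `W ‖b' j - β j‖² / 64` to the loss
at `b' j`. Hence the error halves (`IsRegularBatch.norm_sub_le`).

The energy bounds come from Chernoff bounds on nets of the sphere, the loss bound from a single
Chernoff bound (`pi_not_isRegularBatch_le`). Resampling makes the current iterate independent of the
batch it meets, so the bounds for fixed estimates apply by Fubini. A union bound over iterations and
labels finishes the proof. -/

/-! ### Nets of the unit sphere -/

theorem card_le_of_separated {p : ℕ} {η : ℝ} (hη : 0 < η) (s : Finset (Vec p))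
    (hs : ∀ c ∈ s, ‖c‖ ≤ 1) (h : ∀ c ∈ s, ∀ d ∈ s, c ≠ d → η ≤ ‖c - d‖) :
    (s.card : ℝ) ≤ (1 + 2 / η) ^ p := by
  set m : Measure (Vec p) := volume
  have hδ : 0 < η / 2 := by positivity
  have hρ : 0 < 1 + η / 2 := by positivity
  have hfin : Module.finrank ℝ (Vec p) = p := by simp
  have disj : Set.Pairwise (s : Set (Vec p))
      (Function.onFun Disjoint fun c => Metric.ball c (η / 2)) := by
    rintro c hc d hd hcd
    apply Metric.ball_disjoint_ball
    rw [dist_eq_norm]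
    linarith [h c hc d hd hcd]
  -- Volume comparison: the disjoint balls of radius `η / 2` around the points all fit into the ball
  -- of radius `1 + η / 2`.
  have sub : (⋃ c ∈ s, Metric.ball c (η / 2)) ⊆ Metric.ball (0 : Vec p) (1 + η / 2) := by
    refine Set.iUnion₂_subset fun x hx => Metric.ball_subset_ball' ?_
    rw [dist_zero_right]
    linarith [hs x hx]
  have key : (s.card : ℝ≥0∞) * ENNReal.ofReal ((η / 2) ^ p) * m (Metric.ball 0 1) ≤
      ENNReal.ofReal ((1 + η / 2) ^ p) * m (Metric.ball 0 1) := by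
    have h1 := measure_mono (μ := m) sub
    rw [measure_biUnion_finset disj fun c _ => measurableSet_ball] at h1
    simp only [m.addHaar_ball_of_pos _ hδ, m.addHaar_ball_of_pos _ hρ, hfin] at h1
    simpa [Finset.sum_const, nsmul_eq_mul, mul_assoc] using h1
  have key2 : (s.card : ℝ≥0∞) * ENNReal.ofReal ((η / 2) ^ p) ≤ ENNReal.ofReal ((1 + η / 2) ^ p) :=
    (ENNReal.mul_le_mul_iff_left (Metric.measure_ball_pos _ _ zero_lt_one).ne'
      measure_ball_lt_top.ne).1 key
  have key3 : (s.card : ℝ) * (η / 2) ^ p ≤ (1 + η / 2) ^ p := by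
    have := ENNReal.toReal_le_of_le_ofReal (pow_nonneg hρ.le _) key2
    rwa [ENNReal.toReal_mul, ENNReal.toReal_natCast, ENNReal.toReal_ofReal (by positivity)] at this
  have e : (1 + 2 / η) ^ p = (1 + η / 2) ^ p / (η / 2) ^ p := by
    rw [← div_pow]; congr 1; field_simp; ring
  rw [e, le_div_iff₀ (by positivity)]
  exact key3

/-- A net of the unit sphere. -/
theorem exists_net (p : ℕ) {η : ℝ} (hη : 0 < η) :
    ∃ N : Finset (Vec p), (N.card : ℝ) ≤ (1 + 2 / η) ^ p ∧ (∀ v ∈ N, ‖v‖ = 1) ∧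
      ∀ v : Vec p, ‖v‖ = 1 → ∃ u ∈ N, ‖v - u‖ ≤ η := by
  classical
  -- A separated subset of the sphere of greatest cardinality is a net, since a point far from all
  -- its members could be added. The volume bound ensures that a greatest cardinality exists.
  let P : ℕ → Prop := fun n => ∃ s : Finset (Vec p), s.card = n ∧ (∀ c ∈ s, ‖c‖ = 1) ∧
    ∀ c ∈ s, ∀ d ∈ s, c ≠ d → η ≤ ‖c - d‖
  have hP0 : P 0 := ⟨∅, by simp⟩
  have hbd : ∀ n, P n → n ≤ ⌊(1 + 2 / η) ^ p⌋₊ := by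
    rintro n ⟨s, rfl, h1, h2⟩
    exact Nat.le_floor (card_le_of_separated hη s (fun c hc => (h1 c hc).le) h2)
  obtain ⟨N, hN, h1, h2⟩ := Nat.findGreatest_spec (P := P) (Nat.zero_le ⌊(1 + 2 / η) ^ p⌋₊) hP0
  refine ⟨N, card_le_of_separated hη N (fun c hc => (h1 c hc).le) h2, h1, fun v hv => ?_⟩
  by_contra! hcon
  have hvN : v ∉ N := fun hmem => by
    have := hcon v hmem
    simp at this; linarith
  have : P (N.card + 1) := by
    refine ⟨insert v N, Finset.card_insert_of_notMem hvN, ?_, ?_⟩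
    · intro c hc
      rcases Finset.mem_insert.1 hc with rfl | hc
      exacts [hv, h1 c hc]
    · intro c hc d hd hcd
      rcases Finset.mem_insert.1 hc with rfl | hcN <;> rcases Finset.mem_insert.1 hd with rfl | hdN
      · exact absurd rfl hcd
      · exact (hcon d hdN).le
      · rw [norm_sub_rev]; exact (hcon c hcN).le
      · exact h2 c hcN d hdN hcd
  have h3 := Nat.le_findGreatest (hbd _ this) this
  omega

/-! ### Chernoff bound for product measures -/

/-- Markov's inequality for the exponential of the sum, which factorizes. The parameter of the
Chernoff bound is absorbed into `f`, whose sign is free, so lower tails are covered as well. -/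
theorem pi_measure_sum_ge_le {Z : Type*} [MeasurableSpace Z] (ν : Measure Z)
    [IsProbabilityMeasure ν] (B : ℕ) {f : Z → ℝ} (hf : Measurable f) {a : ℝ} (s : ℝ)
    (h : ∫⁻ z, ENNReal.ofReal (Real.exp (f z)) ∂ν ≤ ENNReal.ofReal (Real.exp a)) :
    (Measure.pi fun _ : Fin B => ν) {z | s ≤ ∑ i, f (z i)} ≤
      ENNReal.ofReal (Real.exp (B * a - s)) := by
  have hm : Measurable fun z => ENNReal.ofReal (Real.exp (f z)) := by fun_prop
  have hprod : ∫⁻ z, ∏ i : Fin B, ENNReal.ofReal (Real.exp (f (z i)))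
      ∂(Measure.pi fun _ : Fin B => ν) = ∏ _i : Fin B, ∫⁻ z, ENNReal.ofReal (Real.exp (f z)) ∂ν := by
    rw [lintegral_prod_eq_prod_lintegral_of_indepFun Finset.univ
      (fun (i : Fin B) (z : Fin B → Z) => ENNReal.ofReal (Real.exp (f (z i))))
      (iIndepFun_pi (X := fun _ z => ENNReal.ofReal (Real.exp (f z))) fun _ => hm.aemeasurable)
      (fun i => hm.comp (measurable_pi_apply i))]
    refine Finset.prod_congr rfl fun i _ => ?_
    exact (measurePreserving_eval (fun _ : Fin B => ν) i).lintegral_comp hm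
  have hset : {z : Fin B → Z | s ≤ ∑ i, f (z i)} =
      {z | ENNReal.ofReal (Real.exp s) ≤ ∏ i : Fin B, ENNReal.ofReal (Real.exp (f (z i)))} := by
    ext z
    simp only [Set.mem_ofPred_eq]
    rw [← ENNReal.ofReal_prod_of_nonneg (fun i _ => (Real.exp_pos _).le), ← Real.exp_sum,
      ENNReal.ofReal_le_ofReal_iff (Real.exp_pos _).le, Real.exp_le_exp]
  have hmark := mul_meas_ge_le_lintegral (μ := Measure.pi fun _ : Fin B => ν)
    (f := fun z => ∏ i : Fin B, ENNReal.ofReal (Real.exp (f (z i))))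
    (Finset.measurable_prod _ fun i _ => hm.comp (measurable_pi_apply i))
    (ENNReal.ofReal (Real.exp s))
  rw [hprod, ← hset] at hmark
  have hle : ∏ _i : Fin B, ∫⁻ z, ENNReal.ofReal (Real.exp (f z)) ∂ν ≤
      ENNReal.ofReal (Real.exp (B * a)) := by
    refine (Finset.prod_le_prod' fun i _ => h).trans ?_
    rw [Finset.prod_const, Finset.card_univ, Fintype.card_fin, ← ENNReal.ofReal_pow
      (Real.exp_pos _).le, ← Real.exp_nat_mul]
  have h2 := hmark.trans hle
  rw [Real.exp_sub, ENNReal.ofReal_div_of_pos (Real.exp_pos _),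
    ENNReal.le_div_iff_mul_le (by simp [Real.exp_pos]) (by simp), mul_comm]
  exact h2

/-! ### Exponential moments of Gaussian projections -/

theorem map_inner_stdGaussian {p : ℕ} {d : Vec p} (hd : ‖d‖ = 1) :
    (stdGaussian (Vec p)).map (fun x => inner ℝ x d) = gaussianReal 0 1 := by
  have h := IsGaussian.map_eq_gaussianReal (μ := stdGaussian (Vec p)) (innerSL ℝ d)
  rw [integral_strongDual_stdGaussian, variance_dual_stdGaussian, innerSL_apply_norm, hd] at h
  have e : (fun x : Vec p => inner ℝ x d) = innerSL ℝ d := by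
    ext x; simp [real_inner_comm]
  rw [e, h]; simp

theorem lintegral_gaussianReal_eq (f : ℝ → ℝ≥0∞) :
    ∫⁻ s, f s ∂(gaussianReal 0 1) =
      ∫⁻ s, ENNReal.ofReal ((√(2 * Real.pi))⁻¹ * Real.exp (-s ^ 2 / 2)) * f s := by
  rw [gaussianReal_of_var_ne_zero 0 one_ne_zero,
    lintegral_withDensity_eq_lintegral_mul_non_measurable _ (measurable_gaussianPDF 0 1)
      (Filter.Eventually.of_forall fun x => gaussianPDF_lt_top)]
  refine lintegral_congr fun s => ?_
  simp [gaussianPDF, gaussianPDFReal]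

theorem lintegral_exp_mul_sq_gaussianReal {κ : ℝ} (hκ : κ < 1 / 2) :
    ∫⁻ s, ENNReal.ofReal (Real.exp (κ * s ^ 2)) ∂(gaussianReal 0 1) =
      ENNReal.ofReal (√(1 / (1 - 2 * κ))) := by
  rw [lintegral_gaussianReal_eq]
  have hb : 0 < 1 / 2 - κ := by linarith
  have e : ∀ s : ℝ, ENNReal.ofReal ((√(2 * Real.pi))⁻¹ * Real.exp (-s ^ 2 / 2)) *
      ENNReal.ofReal (Real.exp (κ * s ^ 2)) =
      ENNReal.ofReal ((√(2 * Real.pi))⁻¹ * Real.exp (-(1 / 2 - κ) * s ^ 2)) := fun s => by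
    rw [← ENNReal.ofReal_mul (by positivity), mul_assoc, ← Real.exp_add]
    congr 3; ring
  simp_rw [e]
  rw [← ofReal_integral_eq_lintegral_ofReal ((integrable_exp_neg_mul_sq hb).const_mul _)
    (Filter.Eventually.of_forall fun s => by positivity), integral_const_mul, integral_gaussian,
    ← Real.sqrt_inv, ← Real.sqrt_mul (by positivity)]
  congr 2
  have : 1 - 2 * κ ≠ 0 := by linarith
  field_simp

/-- For `κ ≤ 1 / 2` the Gaussian density cancels the weight. What remains is at most `1 / √(2π) ≤ 1
/ 2` on an interval of length `2 r`. -/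
theorem setLIntegral_exp_mul_sq_gaussianReal_le {κ r : ℝ} (hκ : κ ≤ 1 / 2) :
    ∫⁻ s in {s : ℝ | |s| ≤ r}, ENNReal.ofReal (Real.exp (κ * s ^ 2)) ∂(gaussianReal 0 1) ≤
      ENNReal.ofReal r := by
  have hS : MeasurableSet {s : ℝ | |s| ≤ r} := measurableSet_le (by fun_prop) (by fun_prop)
  have hpi : (√(2 * Real.pi))⁻¹ ≤ 1 / 2 := by
    rw [one_div]
    refine inv_anti₀ (by norm_num) (Real.le_sqrt_of_sq_le ?_)
    linarith [Real.pi_gt_three]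
  rw [← lintegral_indicator hS, lintegral_gaussianReal_eq]
  calc _ ≤ ∫⁻ s, (Set.Icc (-r) r).indicator (fun _ => ENNReal.ofReal (1 / 2)) s := by
        refine lintegral_mono fun s => ?_
        by_cases hs : |s| ≤ r
        · rw [Set.indicator_of_mem (show s ∈ {s : ℝ | |s| ≤ r} from hs),
            Set.indicator_of_mem (Set.mem_Icc.2 (abs_le.1 hs)), ← ENNReal.ofReal_mul (by positivity),
            mul_assoc, ← Real.exp_add]
          refine ENNReal.ofReal_le_ofReal ?_
          have h1 : Real.exp (-s ^ 2 / 2 + κ * s ^ 2) ≤ 1 :=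
            Real.exp_le_one_iff.2 (by nlinarith [sq_nonneg s])
          calc _ ≤ 1 / 2 * 1 := mul_le_mul hpi h1 (by positivity) (by norm_num)
            _ = 1 / 2 := by norm_num
        · rw [Set.indicator_of_notMem (show s ∉ {s : ℝ | |s| ≤ r} from hs)]
          simp
    _ = ENNReal.ofReal r := by
        rw [lintegral_indicator measurableSet_Icc, setLIntegral_const, Real.volume_Icc,
          ← ENNReal.ofReal_mul (by norm_num)]
        congr 1; ring

theorem lintegral_exp_inner_sq_of_norm_eq_one {p : ℕ} {d : Vec p} (hd : ‖d‖ = 1) {κ : ℝ}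
    (hκ : κ < 1 / 2) :
    ∫⁻ x, ENNReal.ofReal (Real.exp (κ * inner ℝ x d ^ 2)) ∂(stdGaussian (Vec p)) =
      ENNReal.ofReal (√(1 / (1 - 2 * κ))) := by
  rw [← lintegral_exp_mul_sq_gaussianReal hκ, ← map_inner_stdGaussian hd,
    lintegral_map (by fun_prop) (by fun_prop)]

theorem lintegral_exp_inner_sq_le_two {p : ℕ} {a : Vec p} (ha : ‖a‖ ≤ 1) {κ : ℝ}
    (hκ : κ ≤ 1 / 4) :
    ∫⁻ x, ENNReal.ofReal (Real.exp (κ * inner ℝ x a ^ 2)) ∂(stdGaussian (Vec p)) ≤ 2 := by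
  by_cases h0 : a = 0
  · simp [h0]
  have hn : 0 < ‖a‖ := norm_pos_iff.2 h0
  have hd : ‖(‖a‖⁻¹ • a)‖ = 1 := norm_smul_inv_norm h0
  calc _ ≤ ∫⁻ x, ENNReal.ofReal (Real.exp (1 / 4 * inner ℝ x (‖a‖⁻¹ • a) ^ 2))
        ∂(stdGaussian (Vec p)) := by
        refine lintegral_mono fun x => ENNReal.ofReal_le_ofReal (Real.exp_le_exp.2 ?_)
        have e : inner ℝ x a = ‖a‖ * inner ℝ x (‖a‖⁻¹ • a) := by
          rw [inner_smul_right]; field_simp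
        rw [e, mul_pow, ← mul_assoc]
        refine mul_le_mul_of_nonneg_right ?_ (sq_nonneg _)
        nlinarith [pow_le_one₀ (n := 2) hn.le ha, sq_nonneg ‖a‖]
    _ ≤ 2 := by
        rw [lintegral_exp_inner_sq_of_norm_eq_one hd (by norm_num)]
        rw [show (2 : ℝ≥0∞) = ENNReal.ofReal 2 by simp]
        refine ENNReal.ofReal_le_ofReal (Real.sqrt_le_iff.2 ⟨by norm_num, by norm_num⟩)

/-- The component of a standard Gaussian vector along a unit vector is independent of its
component orthogonal to it. -/
theorem indepFun_inner_sub_stdGaussian {p : ℕ} {d : Vec p} (hd : ‖d‖ = 1) :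
    IndepFun (fun x : Vec p => inner ℝ x d) (fun x => x - inner ℝ x d • d)
      (stdGaussian (Vec p)) := by
  let L : Vec p →L[ℝ] ℝ × Vec p :=
    (innerSL ℝ d).prod (ContinuousLinearMap.id ℝ _ - (innerSL ℝ d).smulRight d)
  have hL : (fun x : Vec p => ((inner ℝ x d : ℝ), x - (inner ℝ x d : ℝ) • d)) = L ∘ id := by
    ext x <;> simp [L, real_inner_comm]
  have hG : HasGaussianLaw (fun x : Vec p => ((inner ℝ x d : ℝ), x - (inner ℝ x d : ℝ) • d))
      (stdGaussian (Vec p)) := by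
    rw [hL]; exact IsGaussian.hasGaussianLaw_id.map L
  refine hG.indepFun_of_covariance_inner fun s t => ?_
  have e1 : (fun x : Vec p => inner ℝ s (inner ℝ x d : ℝ)) = fun x => inner ℝ (s • d) x := by
    ext x; simp [inner_smul_left, real_inner_comm, mul_comm]
  have e2 : (fun x : Vec p => inner ℝ t (x - (inner ℝ x d : ℝ) • d)) =
      fun x => inner ℝ (t - (inner ℝ t d : ℝ) • d) x := by
    ext x
    simp only [inner_sub_right, inner_sub_left, inner_smul_left, inner_smul_right,
      RCLike.conj_to_real, real_inner_comm x d]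
    ring
  rw [e1, e2, ← covarianceBilin_apply_eq_cov IsGaussian.memLp_two_id, covarianceBilin_stdGaussian]
  change inner ℝ (s • d) (t - (inner ℝ t d : ℝ) • d) = 0
  rw [inner_smul_left, inner_sub_right, inner_smul_right, real_inner_self_eq_norm_sq, hd,
    real_inner_comm d t]
  ring

/-- The right-hand side of `h` contains `g` itself. For `r ≤ 1 / 4` that part is at most `2 r |g| ≤
|g| / 2` and is absorbed on the left. -/
theorem abs_le_two_mul_of_abs_le {g A A' α α' r : ℝ} (hr0 : 0 ≤ r) (hr : r ≤ 1 / 4)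
    (hα : |α| ≤ 1) (hα' : |α'| ≤ 1) (h : |g| ≤ r * (|A + g * α| + |A' + g * α'|)) :
    |g| ≤ 2 * r * (|A| + |A'|) := by
  have h1 : |A + g * α| ≤ |A| + |g| := by
    refine (abs_add_le _ _).trans ?_
    rw [abs_mul]; nlinarith [abs_nonneg g]
  have h2 : |A' + g * α'| ≤ |A'| + |g| := by
    refine (abs_add_le _ _).trans ?_
    rw [abs_mul]; nlinarith [abs_nonneg g]
  have h3 : r * (|A + g * α| + |A' + g * α'|) ≤ r * (|A| + |g| + (|A'| + |g|)) :=
    mul_le_mul_of_nonneg_left (by linarith) hr0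
  nlinarith [abs_nonneg g]

/-- The linear factor, the width of the window for `⟨x, d⟩`, costs an exponent `1 / 32`. The product
of the two exponentials is then split by the inequality of the means, and the resulting exponent `3
/ 16` stays below the `1 / 4` of `lintegral_exp_inner_sq_le_two`. -/
theorem two_mul_abs_add_abs_mul_exp_le {r A A' : ℝ} (hr0 : 0 ≤ r) :
    2 * r * (|A| + |A'|) * Real.exp (1 / 16 * (A ^ 2 + A' ^ 2)) ≤
      4 * r * (Real.exp (3 / 16 * A ^ 2) + Real.exp (3 / 16 * A' ^ 2)) := by
  have h1 : |A| + |A'| ≤ 4 * Real.exp (1 / 32 * (A ^ 2 + A' ^ 2)) := by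
    have h := Real.add_one_le_exp (1 / 32 * (A ^ 2 + A' ^ 2))
    nlinarith [sq_nonneg (|A| - 4), sq_nonneg (|A'| - 4), sq_abs A, sq_abs A']
  have h2 : Real.exp (3 / 32 * (A ^ 2 + A' ^ 2)) ≤
      (Real.exp (3 / 16 * A ^ 2) + Real.exp (3 / 16 * A' ^ 2)) / 2 := by
    have e1 : Real.exp (3 / 32 * (A ^ 2 + A' ^ 2)) =
        Real.exp (3 / 32 * A ^ 2) * Real.exp (3 / 32 * A' ^ 2) := by
      rw [← Real.exp_add]; congr 1; ring
    have e2 : ∀ s : ℝ, Real.exp (3 / 16 * s) = Real.exp (3 / 32 * s) ^ 2 := fun s => by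
      rw [← Real.exp_nat_mul]; congr 1; push_cast; ring
    rw [e1, e2, e2]
    nlinarith [sq_nonneg (Real.exp (3 / 32 * A ^ 2) - Real.exp (3 / 32 * A' ^ 2))]
  calc _ ≤ 2 * r * (4 * Real.exp (1 / 32 * (A ^ 2 + A' ^ 2))) *
        Real.exp (1 / 16 * (A ^ 2 + A' ^ 2)) := by gcongr
    _ = 8 * r * Real.exp (3 / 32 * (A ^ 2 + A' ^ 2)) := by
        rw [mul_assoc (2 * r), mul_assoc 4, ← Real.exp_add]; ring_nf
    _ ≤ 8 * r * ((Real.exp (3 / 16 * A ^ 2) + Real.exp (3 / 16 * A' ^ 2)) / 2) := by gcongr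
    _ = _ := by ring

/-- For a standard Gaussian vector `x` and a unit vector `d`, the event that `⟨x, d⟩` is at most
`r` times the size of two other projections of `x` has probability `O(r)`, and these projections
remain sub-Gaussian on it. -/
theorem setLIntegral_exp_inner_sq_le {p : ℕ} {d a a' : Vec p} (hd : ‖d‖ = 1) (ha : ‖a‖ ≤ 1)
    (ha' : ‖a'‖ ≤ 1) {r : ℝ} (hr0 : 0 ≤ r) (hr : r ≤ 1 / 4) :
    ∫⁻ x in {x : Vec p | |inner ℝ x d| ≤ r * (|inner ℝ x a| + |inner ℝ x a'|)},
      ENNReal.ofReal (Real.exp (1 / 32 * (inner ℝ x a ^ 2 + inner ℝ x a' ^ 2)))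
      ∂(stdGaussian (Vec p)) ≤ ENNReal.ofReal (16 * r) := by
  set γ := stdGaussian (Vec p)
  set Y : Vec p → Vec p := fun x => x - (inner ℝ x d : ℝ) • d with hY
  have hYm : Measurable Y := by fun_prop
  -- With `g = ⟨x, d⟩`, each projection is `A + g α` with `|α| ≤ 1`, and `(A + g α)² ≤ 2 A² + 2 g²`.
  -- So the exponent `1 / 32` on two projections becomes `1 / 16` on the orthogonal parts and `1 /
  -- 8` on `g²`, in independent variables.
  let F : ℝ × Vec p → ℝ≥0∞ := fun q =>
    {s : ℝ | |s| ≤ 2 * r * (|inner ℝ q.2 a| + |inner ℝ q.2 a'|)}.indicator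
      (fun s => ENNReal.ofReal (Real.exp (1 / 8 * s ^ 2))) q.1 *
      ENNReal.ofReal (Real.exp (1 / 16 * (inner ℝ q.2 a ^ 2 + inner ℝ q.2 a' ^ 2)))
  have hF : Measurable F := by
    have hS : MeasurableSet {q : ℝ × Vec p |
        |q.1| ≤ 2 * r * (|inner ℝ q.2 a| + |inner ℝ q.2 a'|)} :=
      measurableSet_le (by fun_prop) (by fun_prop)
    have h1 : Measurable (Set.indicator {q : ℝ × Vec p |
        |q.1| ≤ 2 * r * (|inner ℝ q.2 a| + |inner ℝ q.2 a'|)}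
        fun q => ENNReal.ofReal (Real.exp (1 / 8 * q.1 ^ 2))) :=
      Measurable.indicator (by fun_prop) hS
    exact h1.mul (by fun_prop)
  have hαa : ∀ v : Vec p, ‖v‖ ≤ 1 → |inner ℝ d v| ≤ 1 := fun v hv =>
    (abs_real_inner_le_norm d v).trans (by rw [hd, one_mul]; exact hv)
  have hdec : ∀ x v : Vec p, inner ℝ x v = inner ℝ (Y x) v + inner ℝ x d * inner ℝ d v :=
    fun x v => by simp [hY, inner_sub_left, inner_smul_left]
  have hYsa : ∀ x v : Vec p, inner ℝ (Y x) v = inner ℝ x (Y v) := fun x v => by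
    simp only [hY, inner_sub_left, inner_sub_right, inner_smul_left, inner_smul_right,
      RCLike.conj_to_real, real_inner_comm d v]
    ring
  have hYn : ∀ v : Vec p, ‖v‖ ≤ 1 → ‖Y v‖ ≤ 1 := fun v hv => by
    have : ‖Y v‖ ^ 2 ≤ ‖v‖ ^ 2 := by
      rw [hY, norm_sub_sq_real, norm_smul, hd, inner_smul_right, mul_one, Real.norm_eq_abs, sq_abs]
      nlinarith [sq_nonneg (inner ℝ v d : ℝ)]
    exact (pow_le_pow_iff_left₀ (norm_nonneg _) (norm_nonneg _) two_ne_zero).1 this |>.trans hv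
  have hSm : MeasurableSet {x : Vec p | |inner ℝ x d| ≤ r * (|inner ℝ x a| + |inner ℝ x a'|)} :=
    measurableSet_le (by fun_prop) (by fun_prop)
  have hsq : ∀ A g α : ℝ, |α| ≤ 1 → (A + g * α) ^ 2 ≤ 2 * A ^ 2 + 2 * g ^ 2 := fun A g α hα => by
    have : α ^ 2 ≤ 1 := (sq_le_one_iff_abs_le_one α).2 hα
    nlinarith [sq_nonneg (A - g * α), sq_nonneg g]
  calc _ ≤ ∫⁻ x, F (inner ℝ x d, Y x) ∂γ := by
        rw [← lintegral_indicator hSm]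
        refine lintegral_mono fun x => ?_
        by_cases hx : |inner ℝ x d| ≤ r * (|inner ℝ x a| + |inner ℝ x a'|)
        · rw [Set.indicator_of_mem (by exact hx)]
          have hx' := hx
          rw [hdec x a, hdec x a'] at hx'
          have h1 := abs_le_two_mul_of_abs_le hr0 hr (hαa a ha) (hαa a' ha') hx'
          simp only [F]
          rw [Set.indicator_of_mem (by exact h1), ← ENNReal.ofReal_mul (Real.exp_pos _).le,
            ← Real.exp_add]
          refine ENNReal.ofReal_le_ofReal (Real.exp_le_exp.2 ?_)
          rw [hdec x a, hdec x a']
          linarith [hsq (inner ℝ (Y x) a) (inner ℝ x d) _ (hαa a ha),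
            hsq (inner ℝ (Y x) a') (inner ℝ x d) _ (hαa a' ha')]
        · rw [Set.indicator_of_notMem (by exact hx)]; exact zero_le
    _ = ∫⁻ q, F q ∂((gaussianReal 0 1).prod (γ.map Y)) := by
        rw [← map_inner_stdGaussian hd, ← (indepFun_inner_sub_stdGaussian hd).map_prod_eq_prod_map_map
          (by fun_prop) hYm.aemeasurable, lintegral_map hF (by fun_prop)]
    _ = ∫⁻ y, ∫⁻ s, F (s, y) ∂(gaussianReal 0 1) ∂(γ.map Y) := by
        have : IsProbabilityMeasure (γ.map Y) := Measure.isProbabilityMeasure_map hYm.aemeasurable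
        exact lintegral_prod_symm' _ hF
    _ ≤ ∫⁻ y, ENNReal.ofReal (4 * r) * (ENNReal.ofReal (Real.exp (3 / 16 * inner ℝ y a ^ 2)) +
          ENNReal.ofReal (Real.exp (3 / 16 * inner ℝ y a' ^ 2))) ∂(γ.map Y) := by
        refine lintegral_mono fun y => ?_
        simp only [F]
        rw [lintegral_mul_const' _ _ ENNReal.ofReal_ne_top,
          lintegral_indicator (measurableSet_le (by fun_prop) (by fun_prop))]
        refine (mul_le_mul_left (setLIntegral_exp_mul_sq_gaussianReal_le (by norm_num)) _).trans ?_
        rw [← ENNReal.ofReal_mul (by positivity), ← ENNReal.ofReal_add (by positivity)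
          (by positivity), ← ENNReal.ofReal_mul (by positivity)]
        exact ENNReal.ofReal_le_ofReal (two_mul_abs_add_abs_mul_exp_le hr0)
    _ ≤ ENNReal.ofReal (4 * r) * (2 + 2) := by
        rw [lintegral_const_mul _ (by fun_prop), lintegral_add_left (by fun_prop)]
        have hb : ∀ v : Vec p, ‖v‖ ≤ 1 →
            ∫⁻ y, ENNReal.ofReal (Real.exp (3 / 16 * inner ℝ y v ^ 2)) ∂(γ.map Y) ≤ 2 :=
          fun v hv => by
            rw [lintegral_map (by fun_prop) hYm]
            simp_rw [hYsa]
            exact lintegral_exp_inner_sq_le_two (hYn v hv) (by norm_num)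
        gcongr
        exacts [hb a ha, hb a' ha']
    _ = ENNReal.ofReal (16 * r) := by
        rw [show (2 + 2 : ℝ≥0∞) = ENNReal.ofReal 4 by norm_num, ← ENNReal.ofReal_mul (by positivity)]
        congr 1; ring

/-! ### Quadratic forms of a batch, controlled on nets -/

/-- The linear map sending `v` to the vector of inner products `⟨x_i, v⟩`, `i ∈ S`. -/
noncomputable def innerFamily {p B : ℕ} (x : Fin B → Vec p) (S : Finset (Fin B)) :
    Vec p →L[ℝ] EuclideanSpace ℝ S :=
  LinearMap.toContinuousLinearMap ((WithLp.linearEquiv 2 ℝ (S → ℝ)).symm.toLinearMap ∘ₗ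
    LinearMap.pi fun i : S => (innerSL ℝ (x i)).toLinearMap)

theorem norm_innerFamily_sq {p B : ℕ} (x : Fin B → Vec p) (S : Finset (Fin B)) (v : Vec p) :
    ‖innerFamily x S v‖ ^ 2 = ∑ i ∈ S, inner ℝ (x i) v ^ 2 := by
  rw [EuclideanSpace.real_norm_sq_eq, ← Finset.sum_coe_sort S fun i => inner ℝ (x i) v ^ 2]
  rfl

theorem opNorm_le_of_net {p : ℕ} {F : Type*} [NormedAddCommGroup F] [NormedSpace ℝ F]
    (L : Vec p →L[ℝ] F) {N : Finset (Vec p)}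
    (hN : ∀ v : Vec p, ‖v‖ = 1 → ∃ u ∈ N, ‖v - u‖ ≤ 1 / 2) {M : ℝ} (hM0 : 0 ≤ M)
    (hM : ∀ u ∈ N, ‖L u‖ ≤ M) : ‖L‖ ≤ 2 * M := by
  have h : ‖L‖ ≤ M + ‖L‖ / 2 := by
    refine L.opNorm_le_of_unit_norm (by positivity) fun v hv => ?_
    obtain ⟨u, hu, huv⟩ := hN v hv
    have h1 : L v = L u + L (v - u) := by simp
    calc ‖L v‖ ≤ ‖L u‖ + ‖L (v - u)‖ := by rw [h1]; exact norm_add_le _ _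
      _ ≤ M + ‖L‖ * (1 / 2) :=
          add_le_add (hM u hu) ((L.le_opNorm _).trans (by gcongr))
      _ = M + ‖L‖ / 2 := by ring
  linarith

/-- The upper bound on `S` gives operator norm at most `8 √W`, and dropping terms keeps this for
`S'`. Moving by `1 / 64` to a net point then changes the norm by at most `√W / 8`, half of the lower
bound `√W / 4` on the net. -/
theorem mul_norm_sq_le_of_net {p B : ℕ} (x : Fin B → Vec p) {S S' : Finset (Fin B)}
    (hS : S' ⊆ S) {N N' : Finset (Vec p)}
    (hN : ∀ v : Vec p, ‖v‖ = 1 → ∃ u ∈ N, ‖v - u‖ ≤ 1 / 2)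
    (hN' : ∀ v : Vec p, ‖v‖ = 1 → ∃ u ∈ N', ‖v - u‖ ≤ 1 / 64) {W : ℝ} (hW : 0 ≤ W)
    (hup : ∀ u ∈ N, ∑ i ∈ S, inner ℝ (x i) u ^ 2 ≤ 16 * W)
    (hlow : ∀ u ∈ N', W / 16 ≤ ∑ i ∈ S', inner ℝ (x i) u ^ 2) (v : Vec p) :
    W / 64 * ‖v‖ ^ 2 ≤ ∑ i ∈ S', inner ℝ (x i) v ^ 2 := by
  set L := innerFamily x S
  set L' := innerFamily x S'
  have hsqW : √W ^ 2 = W := Real.sq_sqrt hW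
  have hL : ‖L‖ ≤ 2 * (4 * √W) := by
    refine opNorm_le_of_net L hN (by positivity) fun u hu => ?_
    refine (pow_le_pow_iff_left₀ (norm_nonneg _) (by positivity) two_ne_zero).1 ?_
    rw [norm_innerFamily_sq, mul_pow, hsqW]
    linarith [hup u hu]
  have hL' : ∀ w, ‖L' w‖ ≤ ‖L‖ * ‖w‖ := fun w => by
    refine le_trans ?_ (L.le_opNorm w)
    refine (pow_le_pow_iff_left₀ (norm_nonneg _) (norm_nonneg _) two_ne_zero).1 ?_
    rw [norm_innerFamily_sq, norm_innerFamily_sq]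
    exact Finset.sum_le_sum_of_subset_of_nonneg hS fun i _ _ => sq_nonneg _
  have hunit : ∀ w : Vec p, ‖w‖ = 1 → √W / 8 ≤ ‖L' w‖ := fun w hw => by
    obtain ⟨u, hu, huw⟩ := hN' w hw
    have h1 : √W / 4 ≤ ‖L' u‖ := by
      refine (pow_le_pow_iff_left₀ (by positivity) (norm_nonneg _) two_ne_zero).1 ?_
      rw [norm_innerFamily_sq, div_pow, hsqW]
      linarith [hlow u hu]
    have h2 : ‖L' (w - u)‖ ≤ √W / 8 :=
      calc ‖L' (w - u)‖ ≤ ‖L‖ * ‖w - u‖ := hL' _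
        _ ≤ 2 * (4 * √W) * (1 / 64) := by gcongr
        _ = √W / 8 := by ring
    have h3 : ‖L' u‖ ≤ ‖L' w‖ + ‖L' (w - u)‖ := by
      have : L' u = L' w - L' (w - u) := by simp
      rw [this]; exact norm_sub_le _ _
    linarith
  have hall : √W / 8 * ‖v‖ ≤ ‖L' v‖ := by
    by_cases h0 : v = 0
    · simp [h0]
    have h1 := hunit _ (norm_smul_inv_norm (𝕜 := ℝ) h0)
    rw [map_smul, norm_smul] at h1
    have hv : 0 < ‖v‖ := norm_pos_iff.2 h0
    simp only [RCLike.ofReal_real_eq_id, id_eq, norm_inv, norm_norm] at h1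
    rwa [inv_mul_eq_div, le_div_iff₀ hv] at h1
  rw [← norm_innerFamily_sq]
  calc W / 64 * ‖v‖ ^ 2 = (√W / 8 * ‖v‖) ^ 2 := by rw [mul_pow, div_pow, hsqW]; ring
    _ ≤ _ := by gcongr

/-! ### Contraction on a regular batch -/

/-- The covariate `x` allows the estimates `b` to confuse the labels `l` and `j`. -/
def Confused {k p : ℕ} (β b : Fin k → Vec p) (l j : Fin k) (x : Vec p) : Prop :=
  |inner ℝ x (β l - β j)| ≤ |inner ℝ x (b l - β l)| + |inner ℝ x (b j - β j)|

open Classical in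
/-- The squared response to `v` of a sample with true label `j`. -/
noncomputable def labelEnergy {k p : ℕ} (j : Fin k) (v : Vec p) (q : Vec p × Fin k) : ℝ :=
  if q.2 = j then inner ℝ q.1 v ^ 2 else 0

open Classical in
/-- The squared response to `v` of a sample with true label `j` that is certainly labelled
correctly with the estimates `b`. -/
noncomputable def clearEnergy {k p : ℕ} (β b : Fin k → Vec p) (j : Fin k) (v : Vec p)
    (q : Vec p × Fin k) : ℝ :=
  if q.2 = j ∧ ∀ m, m ≠ j → ¬ Confused β b j m q.1 then inner ℝ q.1 v ^ 2 else 0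

open Classical in
/-- A bound for the squared residual at `β j` of a sample that may be given the label `j`
incorrectly. -/
noncomputable def confusionLoss {k p : ℕ} (β b : Fin k → Vec p) (j : Fin k)
    (q : Vec p × Fin k) : ℝ :=
  if q.2 ≠ j ∧ Confused β b q.2 j q.1 then
    (|inner ℝ q.1 (b q.2 - β q.2)| + |inner ℝ q.1 (b j - β j)|) ^ 2 else 0

/-- The event on a batch on which the update of the `j`-th estimate contracts. -/
structure IsRegularBatch {k p B : ℕ} (β b : Fin k → Vec p) (j : Fin k) (W ε : ℝ)
    (N N' : Finset (Vec p)) (q : Fin B → Vec p × Fin k) : Prop where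
  upper : ∀ v ∈ N, ∑ i, labelEnergy j v (q i) ≤ 16 * W
  lower : ∀ v ∈ N', W / 16 ≤ ∑ i, clearEnergy β b j v (q i)
  loss : ∑ i, confusionLoss β b j (q i) ≤ W * ε ^ 2 / 256

theorem confused_of_isLabelAssignment {k p B : ℕ} {β b : Fin k → Vec p}
    {q : Fin B → Vec p × Fin k} {y : Fin B → ℝ} {z : Fin B → Fin k}
    (hy : ∀ i, y i = inner ℝ (q i).1 (β (q i).2))
    (hz : IsLabelAssignment (fun i => (q i).1) y b z) (i : Fin B) :
    Confused β b (q i).2 (z i) (q i).1 := by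
  have h := hz i (q i).2
  simp only [hy, ← inner_sub_right] at h
  have e : β (q i).2 - β (z i) = (β (q i).2 - b (z i)) + (b (z i) - β (z i)) := by abel
  unfold Confused
  rw [e, inner_add_right]
  refine (abs_add_le _ _).trans (add_le_add_left (h.trans_eq ?_) _)
  rw [← neg_sub (b _) (β _), inner_neg_right, abs_neg]

/-- Both sums are compared with the loss of label `j`. At `b' j` the clear samples are among its
terms, as they must carry the label `j`. At `β j` the correctly labelled samples contribute nothing,
as there is no noise. Only minimality is used, so ties and degenerate least squares do no harm. -/
theorem sum_clearEnergy_le_sum_confusionLoss {k p B : ℕ} {β b b' : Fin k → Vec p}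
    {q : Fin B → Vec p × Fin k} {y : Fin B → ℝ} {z : Fin B → Fin k}
    (hy : ∀ i, y i = inner ℝ (q i).1 (β (q i).2))
    (hz : IsLabelAssignment (fun i => (q i).1) y b z)
    (hb' : IsParameterUpdate (fun i => (q i).1) y z b') (j : Fin k) :
    ∑ i, clearEnergy β b j (b' j - β j) (q i) ≤ ∑ i, confusionLoss β b j (q i) := by
  classical
  have hconf := confused_of_isLabelAssignment hy hz
  calc ∑ i, clearEnergy β b j (b' j - β j) (q i)
      ≤ labelLoss (fun i => (q i).1) y z j (b' j) := by
        refine Finset.sum_le_sum fun i _ => ?_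
        unfold clearEnergy
        split_ifs with h1 h2 h2
        · rw [hy i, h1.1, ← inner_sub_right, mul_one, ← neg_sub (b' j), inner_neg_right, neg_sq]
        · exact absurd (h1.1 ▸ hconf i) (h1.2 _ h2)
        · rw [mul_one]; exact sq_nonneg _
        · rw [mul_zero]
    _ ≤ labelLoss (fun i => (q i).1) y z j (β j) := hb' j (β j)
    _ ≤ ∑ i, confusionLoss β b j (q i) := by
        refine Finset.sum_le_sum fun i _ => ?_
        unfold confusionLoss
        by_cases hzi : z i = j
        · subst hzi
          rw [if_pos rfl, mul_one, hy i, ← inner_sub_right]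
          by_cases hq : (q i).2 = z i
          · simp [hq]
          · rw [if_pos ⟨hq, hconf i⟩, ← sq_abs]
            exact pow_le_pow_left₀ (abs_nonneg _) (hconf i) 2
        · rw [if_neg hzi, mul_zero]
          split_ifs <;> positivity

theorem IsRegularBatch.norm_sub_le {k p B : ℕ} {β b b' : Fin k → Vec p} {j : Fin k} {W ε : ℝ}
    {N N' : Finset (Vec p)} {q : Fin B → Vec p × Fin k} (h : IsRegularBatch β b j W ε N N' q)
    (hN : ∀ v : Vec p, ‖v‖ = 1 → ∃ u ∈ N, ‖v - u‖ ≤ 1 / 2)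
    (hN' : ∀ v : Vec p, ‖v‖ = 1 → ∃ u ∈ N', ‖v - u‖ ≤ 1 / 64) (hW : 0 < W) (hε : 0 ≤ ε)
    {y : Fin B → ℝ} {z : Fin B → Fin k}
    (hy : ∀ i, y i = inner ℝ (q i).1 (β (q i).2))
    (hz : IsLabelAssignment (fun i => (q i).1) y b z)
    (hb' : IsParameterUpdate (fun i => (q i).1) y z b') : ‖b' j - β j‖ ≤ ε / 2 := by
  classical
  have hclear : ∀ v, ∑ i, clearEnergy β b j v (q i) = ∑ i ∈ Finset.univ.filter
      (fun i => (q i).2 = j ∧ ∀ m, m ≠ j → ¬ Confused β b j m (q i).1),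
      inner ℝ (q i).1 v ^ 2 := fun v => by
    rw [Finset.sum_filter]
    exact Finset.sum_congr rfl fun i _ => by unfold clearEnergy; congr
  have hlabel : ∀ v, ∑ i, labelEnergy j v (q i) = ∑ i ∈ Finset.univ.filter
      (fun i => (q i).2 = j), inner ℝ (q i).1 v ^ 2 := fun v => by
    rw [Finset.sum_filter]
    exact Finset.sum_congr rfl fun i _ => by unfold labelEnergy; congr
  have h1 := mul_norm_sq_le_of_net (fun i => (q i).1)
    (S := Finset.univ.filter fun i => (q i).2 = j)
    (S' := Finset.univ.filter
      fun i => (q i).2 = j ∧ ∀ m, m ≠ j → ¬ Confused β b j m (q i).1)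
    (fun i hi => by simp only [Finset.mem_filter, Finset.mem_univ, true_and] at hi ⊢; exact hi.1)
    hN hN' hW.le (fun u hu => (hlabel u).symm.trans_le (h.upper u hu))
    (fun u hu => (h.lower u hu).trans_eq (hclear u)) (b' j - β j)
  rw [← hclear] at h1
  have h2 := h1.trans ((sum_clearEnergy_le_sum_confusionLoss hy hz hb' j).trans h.loss)
  refine (pow_le_pow_iff_left₀ (norm_nonneg _) (by positivity) two_ne_zero).1 ?_
  refine le_of_mul_le_mul_left ?_ (show 0 < W / 64 by positivity)
  linarith

/-! ### Relabelling the estimates -/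

/-- The algorithm commutes with relabelling, so one permutation, chosen for the initial estimates,
serves all iterations. -/
theorem IsLabelAssignment.perm {k p B : ℕ} {x : Fin B → Vec p} {y : Fin B → ℝ}
    {b : Fin k → Vec p} {z : Fin B → Fin k} (h : IsLabelAssignment x y b z)
    (π : Equiv.Perm (Fin k)) :
    IsLabelAssignment x y (fun j => b (π.symm j)) (fun i => π (z i)) := fun i j => by
  simpa using h i (π.symm j)

theorem IsParameterUpdate.perm {k p B : ℕ} {x : Fin B → Vec p} {y : Fin B → ℝ}
    {b : Fin k → Vec p} {z : Fin B → Fin k} (h : IsParameterUpdate x y z b)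
    (π : Equiv.Perm (Fin k)) :
    IsParameterUpdate x y (fun i => π (z i)) (fun j => b (π.symm j)) := fun j v => by
  have e : ∀ i, (π (z i) = j) = (z i = π.symm j) := fun i => by rw [Equiv.eq_symm_apply]
  simpa only [labelLoss, e] using h (π.symm j) v

theorem estimationError_nonneg {k p : ℕ} (b β : Fin k → Vec p) : 0 ≤ estimationError b β :=
  Real.iInf_nonneg fun _ => Real.iSup_nonneg fun _ => norm_nonneg _

theorem exists_perm_norm_sub_le {k p : ℕ} (b β : Fin k → Vec p) :
    ∃ π : Equiv.Perm (Fin k), ∀ j, ‖b (π.symm j) - β j‖ ≤ estimationError b β := by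
  obtain ⟨π, hπ⟩ := exists_eq_ciInf_of_finite
    (f := fun π : Equiv.Perm (Fin k) => ⨆ j : Fin k, ‖b j - β (π j)‖)
  refine ⟨π, fun j => ?_⟩
  rw [estimationError, ← hπ]
  simpa using le_ciSup (Set.finite_range fun j : Fin k => ‖b j - β (π j)‖).bddAbove (π.symm j)

theorem estimationError_le {k p : ℕ} {b β : Fin k → Vec p} {ε : ℝ} (hε : 0 ≤ ε)
    (π : Equiv.Perm (Fin k)) (h : ∀ j, ‖b (π.symm j) - β j‖ ≤ ε) : estimationError b β ≤ ε := by
  refine (ciInf_le (Set.finite_range _).bddBelow π).trans (Real.iSup_le (fun j => ?_) hε)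
  simpa using h (π j)

/-! ### Joint measurability in estimates and samples -/

theorem measurable_of_label {α : Type*} [MeasurableSpace α] {k p : ℕ}
    {f : α × (Vec p × Fin k) → ℝ} (h : ∀ l, Measurable fun r : α × Vec p => f (r.1, (r.2, l))) :
    Measurable f := by
  have h1 : Measurable fun r : (α × Vec p) × Fin k => f (r.1.1, (r.1.2, r.2)) :=
    measurable_from_prod_countable_left h
  exact h1.comp (g := fun r : (α × Vec p) × Fin k => f (r.1.1, (r.1.2, r.2)))
    (f := fun r : α × (Vec p × Fin k) => ((r.1, r.2.1), r.2.2)) (by fun_prop)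

theorem measurableSet_confused {k p : ℕ} (β : Fin k → Vec p) (l j : Fin k) :
    MeasurableSet {r : (Fin k → Vec p) × Vec p | Confused β r.1 l j r.2} :=
  measurableSet_le (by fun_prop) (by fun_prop)

theorem measurable_labelEnergy {k p : ℕ} (j : Fin k) (v : Vec p) :
    Measurable (labelEnergy j v) := by
  have h : Measurable fun r : Unit × (Vec p × Fin k) => labelEnergy j v r.2 := by
    refine measurable_of_label fun l => ?_
    unfold labelEnergy
    by_cases hl : l = j
    · simp only [hl, if_true]; fun_prop
    · simp only [hl, if_false]; fun_prop
  exact h.comp (measurable_const (a := ()) |>.prodMk measurable_id)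

theorem measurable_clearEnergy {k p : ℕ} (β : Fin k → Vec p) (j : Fin k) (v : Vec p) :
    Measurable fun r : (Fin k → Vec p) × (Vec p × Fin k) => clearEnergy β r.1 j v r.2 := by
  refine measurable_of_label fun l => ?_
  unfold clearEnergy
  dsimp only
  refine Measurable.ite ?_ (by fun_prop) (by fun_prop)
  rw [show {r : (Fin k → Vec p) × Vec p | l = j ∧ ∀ m, m ≠ j → ¬ Confused β r.1 j m r.2} =
    {_r | l = j} ∩ ⋂ m, ⋂ (_ : m ≠ j), {r | Confused β r.1 j m r.2}ᶜ by ext; simp]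
  exact (MeasurableSet.const _).inter (MeasurableSet.iInter fun m => MeasurableSet.iInter fun _ =>
    (measurableSet_confused β j m).compl)

theorem measurable_confusionLoss {k p : ℕ} (β : Fin k → Vec p) (j : Fin k) :
    Measurable fun r : (Fin k → Vec p) × (Vec p × Fin k) => confusionLoss β r.1 j r.2 := by
  refine measurable_of_label fun l => ?_
  unfold confusionLoss
  dsimp only
  refine Measurable.ite ?_ (by fun_prop) (by fun_prop)
  rw [show {r : (Fin k → Vec p) × Vec p | l ≠ j ∧ Confused β r.1 l j r.2} =
    {_r | l ≠ j} ∩ {r | Confused β r.1 l j r.2} by ext; simp]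
  exact (MeasurableSet.const _).inter (measurableSet_confused β l j)

theorem measurableSet_isRegularBatch {k p B : ℕ} (β : Fin k → Vec p) (j : Fin k) (W ε : ℝ)
    (N N' : Finset (Vec p)) :
    MeasurableSet {r : (Fin k → Vec p) × (Fin B → Vec p × Fin k) |
      IsRegularBatch β r.1 j W ε N N' r.2} := by
  have e : {r : (Fin k → Vec p) × (Fin B → Vec p × Fin k) | IsRegularBatch β r.1 j W ε N N' r.2} =
      ((⋂ v ∈ N, {r | ∑ i, labelEnergy j v (r.2 i) ≤ 16 * W}) ∩
      (⋂ v ∈ N', {r | W / 16 ≤ ∑ i, clearEnergy β r.1 j v (r.2 i)})) ∩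
      {r | ∑ i, confusionLoss β r.1 j (r.2 i) ≤ W * ε ^ 2 / 256} := by
    ext r
    simp only [Set.mem_ofPred_eq, Set.mem_inter_iff, Set.mem_iInter]
    exact ⟨fun h => ⟨⟨h.upper, h.lower⟩, h.loss⟩, fun h => ⟨h.1.1, h.1.2, h.2⟩⟩
  have hpair : ∀ i : Fin B, Measurable
      fun r : (Fin k → Vec p) × (Fin B → Vec p × Fin k) => (r.1, r.2 i) := fun i => by fun_prop
  rw [e]
  refine ((Finset.measurableSet_biInter _ fun v _ => ?_).inter
    (Finset.measurableSet_biInter _ fun v _ => ?_)).inter ?_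
  · exact measurableSet_le (Finset.measurable_sum _ fun i _ =>
      (measurable_labelEnergy j v).comp (by fun_prop)) measurable_const
  · exact measurableSet_le measurable_const (Finset.measurable_sum _ fun i _ =>
      (measurable_clearEnergy β j v).comp (hpair i))
  · exact measurableSet_le (Finset.measurable_sum _ fun i _ =>
      (measurable_confusionLoss β j).comp (hpair i)) measurable_const

/-! ### Exponential moments of one sample -/

/-- The law on the labels with weights `w`. -/
noncomputable def labelLaw {k : ℕ} (w : Fin k → ℝ) : Measure (Fin k) :=
  ∑ j, ENNReal.ofReal (w j) • Measure.dirac j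

theorem isProbabilityMeasure_labelLaw {k : ℕ} {w : Fin k → ℝ} (hw : ∀ j, 0 ≤ w j)
    (hw1 : ∑ j, w j = 1) : IsProbabilityMeasure (labelLaw w) := ⟨by
  simp only [labelLaw, Measure.coe_finsetSum, Finset.sum_apply, Measure.smul_apply, measure_univ,
    smul_eq_mul, mul_one]
  rw [← ENNReal.ofReal_sum_of_nonneg fun j _ => hw j, hw1, ENNReal.ofReal_one]⟩

theorem eq_labelLaw {k : ℕ} {w : Fin k → ℝ} {ρ : Measure (Fin k)}
    (h : ∀ j, ρ {j} = ENNReal.ofReal (w j)) : ρ = labelLaw w := by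
  refine Measure.ext_of_singleton fun j => ?_
  simp [h, labelLaw, Measure.coe_finsetSum, Set.indicator_apply]

/-- The law of one sample: a standard Gaussian covariate with an independent label. -/
noncomputable def sampleLaw {k : ℕ} (p : ℕ) (w : Fin k → ℝ) : Measure (Vec p × Fin k) :=
  (stdGaussian (Vec p)).prod (labelLaw w)

theorem lintegral_exp_sampleLaw_le {k p : ℕ} {w : Fin k → ℝ} (hw : ∀ j, 0 ≤ w j)
    (hw1 : ∑ j, w j = 1) {f : Vec p × Fin k → ℝ} (hf : Measurable f) {c : Fin k → ℝ}
    (hc : ∀ l, 0 ≤ 1 + c l)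
    (h : ∀ l, ∫⁻ x, ENNReal.ofReal (Real.exp (f (x, l))) ∂(stdGaussian (Vec p)) ≤
      ENNReal.ofReal (1 + c l)) {a : ℝ} (ha : ∑ l, w l * c l ≤ a) :
    ∫⁻ q, ENNReal.ofReal (Real.exp (f q)) ∂(sampleLaw p w) ≤ ENNReal.ofReal (Real.exp a) := by
  have := isProbabilityMeasure_labelLaw hw hw1
  rw [sampleLaw, lintegral_prod_symm' _ (by fun_prop), labelLaw, lintegral_finsetSum_measure]
  simp only [lintegral_smul_measure, lintegral_dirac, smul_eq_mul]
  calc _ ≤ ∑ l, ENNReal.ofReal (w l) * ENNReal.ofReal (1 + c l) := by gcongr with l; exact h l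
    _ = ENNReal.ofReal (∑ l, w l * (1 + c l)) := by
        rw [ENNReal.ofReal_sum_of_nonneg fun l _ => mul_nonneg (hw l) (hc l)]
        exact Finset.sum_congr rfl fun l _ => (ENNReal.ofReal_mul (hw l)).symm
    _ ≤ ENNReal.ofReal (Real.exp a) := by
        refine ENNReal.ofReal_le_ofReal ?_
        simp only [mul_add, mul_one, Finset.sum_add_distrib, hw1]
        linarith [Real.add_one_le_exp a]

theorem setLIntegral_confused_le {k p : ℕ} {β b : Fin k → Vec p} {ε ρ : ℝ}
    (hb : ∀ l, ‖b l - β l‖ ≤ ε) {l j : Fin k} (hne : β l ≠ β j)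
    (hρ : ε ≤ ρ * ‖β l - β j‖) (hρ4 : ρ ≤ 1 / 4) :
    ∫⁻ x in {x | Confused β b l j x}, ENNReal.ofReal (Real.exp (1 / 32 *
      (inner ℝ x (ε⁻¹ • (b l - β l)) ^ 2 + inner ℝ x (ε⁻¹ • (b j - β j)) ^ 2)))
      ∂(stdGaussian (Vec p)) ≤ ENNReal.ofReal (16 * ρ) := by
  have hε : 0 ≤ ε := (norm_nonneg _).trans (hb l)
  have hD : 0 < ‖β l - β j‖ := norm_pos_iff.2 (sub_ne_zero.2 hne)
  have hρ0 : 0 ≤ ρ := nonneg_of_mul_nonneg_left (hε.trans hρ) hD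
  have hunit : ∀ m, ‖ε⁻¹ • (b m - β m)‖ ≤ 1 := fun m => by
    rw [norm_smul, norm_inv, Real.norm_of_nonneg hε]
    exact inv_mul_le_one_of_le₀ (hb m) hε
  -- This also holds for `ε = 0`, where `ε⁻¹ = 0` but `b m = β m`.
  have hsc : ∀ m, b m - β m = ε • ε⁻¹ • (b m - β m) := fun m => by
    rcases hε.eq_or_lt with h0 | h0
    · have := hb m
      rw [← h0] at this
      rw [norm_le_zero_iff.1 this]; simp
    · rw [smul_inv_smul₀ h0.ne']
  refine le_trans (lintegral_mono_set fun x hx => ?_)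
    (setLIntegral_exp_inner_sq_le (norm_smul_inv_norm (𝕜 := ℝ) (sub_ne_zero.2 hne))
      (hunit l) (hunit j) hρ0 hρ4)
  have hx' : |inner ℝ x (β l - β j)| ≤ |inner ℝ x (b l - β l)| + |inner ℝ x (b j - β j)| := hx
  rw [hsc l, hsc j, inner_smul_right _ _ ε, inner_smul_right _ _ ε, abs_mul, abs_mul,
    abs_of_nonneg hε, ← mul_add] at hx'
  simp only [Set.mem_ofPred_eq]
  rw [inner_smul_right, abs_mul, RCLike.ofReal_real_eq_id, id_eq, abs_inv, abs_norm,
    inv_mul_le_iff₀ hD]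
  refine hx'.trans ?_
  rw [← mul_assoc, mul_comm ‖_‖ ρ]
  exact mul_le_mul_of_nonneg_right hρ (by positivity)

theorem measurableSet_confused_right {k p : ℕ} (β b : Fin k → Vec p) (l j : Fin k) :
    MeasurableSet {x | Confused β b l j x} :=
  measurableSet_le (by fun_prop) (by fun_prop)

theorem stdGaussian_confused_le {k p : ℕ} {β b : Fin k → Vec p} {ε ρ : ℝ}
    (hb : ∀ l, ‖b l - β l‖ ≤ ε) {l j : Fin k} (hne : β l ≠ β j)
    (hρ : ε ≤ ρ * ‖β l - β j‖) (hρ4 : ρ ≤ 1 / 4) :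
    stdGaussian (Vec p) {x | Confused β b l j x} ≤ ENNReal.ofReal (16 * ρ) := by
  rw [← setLIntegral_one]
  refine le_trans (lintegral_mono fun x => ?_) (setLIntegral_confused_le hb hne hρ hρ4)
  exact ENNReal.one_le_ofReal.2 (Real.one_le_exp (by positivity))

/-- A possibly confused sample has clear energy `0` and contributes at most its probability, in
total at most `16 k ρ ≤ 1 / 4`. The exponent `-3 / 2` makes the Gaussian moment exactly `1 / 2`. -/
theorem lintegral_exp_clearEnergy_le {k p : ℕ} {β b : Fin k → Vec p} {ε ρ : ℝ}
    (hb : ∀ l, ‖b l - β l‖ ≤ ε) {j : Fin k}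
    (hsep : ∀ m, m ≠ j → β j ≠ β m ∧ ε ≤ ρ * ‖β j - β m‖) (hρ0 : 0 ≤ ρ)
    (hρ : 64 * k * ρ ≤ 1) {v : Vec p} (hv : ‖v‖ = 1) :
    ∫⁻ x, ENNReal.ofReal (Real.exp (-(3 / 2) * clearEnergy β b j v (x, j)))
      ∂(stdGaussian (Vec p)) ≤ ENNReal.ofReal (1 + -(1 / 4)) := by
  classical
  have hk : (1 : ℝ) ≤ k := by exact_mod_cast j.pos
  have hρ4 : ρ ≤ 1 / 4 := by nlinarith
  calc _ ≤ ∫⁻ x, (ENNReal.ofReal (Real.exp (-(3 / 2) * inner ℝ x v ^ 2)) +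
        ∑ m ∈ Finset.univ.erase j, {x | Confused β b j m x}.indicator (fun _ => 1) x)
        ∂(stdGaussian (Vec p)) := by
        refine lintegral_mono fun x => ?_
        by_cases h : ∀ m, m ≠ j → ¬ Confused β b j m x
        · simp only [clearEnergy, true_and, if_pos h]
          exact le_self_add
        · simp only [clearEnergy, true_and, if_neg h]
          push Not at h
          obtain ⟨m, hm, hc⟩ := h
          refine le_trans ?_ (le_add_of_nonneg_left zero_le)
          refine le_trans ?_ (Finset.single_le_sum
            (f := fun m => {x | Confused β b j m x}.indicator (fun _ => (1 : ℝ≥0∞)) x)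
            (fun _ _ => zero_le) (Finset.mem_erase.2 ⟨hm, Finset.mem_univ m⟩))
          simp [hc]
    _ = ENNReal.ofReal (√(1 / (1 - 2 * (-(3 / 2))))) +
        ∑ m ∈ Finset.univ.erase j, stdGaussian (Vec p) {x | Confused β b j m x} := by
        rw [lintegral_add_left (by fun_prop),
          lintegral_exp_inner_sq_of_norm_eq_one hv (by norm_num), lintegral_finsetSum]
        · congr 1
          refine Finset.sum_congr rfl fun m _ => ?_
          rw [lintegral_indicator_const (measurableSet_confused_right β b j m), one_mul]
        · exact fun m _ => measurable_const.indicator (measurableSet_confused_right β b j m)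
    _ ≤ ENNReal.ofReal (1 / 2) + ∑ _m : Fin k, ENNReal.ofReal (16 * ρ) := by
        gcongr
        · refine Real.sqrt_le_iff.2 ⟨by norm_num, by norm_num⟩
        · refine (Finset.sum_le_sum fun m hm => ?_).trans
            (Finset.sum_le_sum_of_subset (Finset.erase_subset j _))
          have hm' := hsep m (Finset.ne_of_mem_erase hm)
          exact stdGaussian_confused_le hb hm'.1 hm'.2 hρ4
    _ ≤ _ := by
        rw [Finset.sum_const, Finset.card_univ, Fintype.card_fin, nsmul_eq_mul,
          ← ENNReal.ofReal_natCast, ← ENNReal.ofReal_mul (by positivity),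
          ← ENNReal.ofReal_add (by norm_num) (by positivity)]
        exact ENNReal.ofReal_le_ofReal (by linarith)

theorem lintegral_exp_confusionLoss_le {k p : ℕ} {β b : Fin k → Vec p} {ε ρ : ℝ}
    (hb : ∀ l, ‖b l - β l‖ ≤ ε) {l j : Fin k} (hne : β l ≠ β j)
    (hρ : ε ≤ ρ * ‖β l - β j‖) (hρ4 : ρ ≤ 1 / 4) (hρ0 : 0 ≤ ρ) :
    ∫⁻ x, ENNReal.ofReal (Real.exp (1 / 64 * (ε⁻¹ ^ 2 * confusionLoss β b j (x, l))))
      ∂(stdGaussian (Vec p)) ≤ ENNReal.ofReal (1 + 16 * ρ) := by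
  classical
  have hlj : l ≠ j := fun h => hne (by rw [h])
  calc _ ≤ ∫⁻ x, (1 + {x | Confused β b l j x}.indicator (fun x => ENNReal.ofReal (Real.exp (1 / 32 *
      (inner ℝ x (ε⁻¹ • (b l - β l)) ^ 2 + inner ℝ x (ε⁻¹ • (b j - β j)) ^ 2)))) x)
      ∂(stdGaussian (Vec p)) := by
        refine lintegral_mono fun x => ?_
        by_cases h : Confused β b l j x
        · rw [Set.indicator_of_mem (by exact h)]
          refine le_trans (ENNReal.ofReal_le_ofReal (Real.exp_le_exp.2 ?_)) le_add_self
          simp only [confusionLoss, if_pos (show l ≠ j ∧ Confused β b l j x from ⟨hlj, h⟩),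
            inner_smul_right, mul_pow]
          rw [← mul_add]
          -- This factor `2` turns `1 / 64` into the exponent `1 / 32` of
          -- `setLIntegral_confused_le`.
          have h2 : ∀ s t : ℝ, (|s| + |t|) ^ 2 ≤ 2 * (s ^ 2 + t ^ 2) := fun s t => by
            nlinarith [sq_nonneg (|s| - |t|), sq_abs s, sq_abs t]
          nlinarith [mul_le_mul_of_nonneg_left (h2 (inner ℝ x (b l - β l)) (inner ℝ x (b j - β j)))
            (sq_nonneg ε⁻¹)]
        · simp [confusionLoss, h]
    _ ≤ 1 + ENNReal.ofReal (16 * ρ) := by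
        rw [lintegral_add_left measurable_const, lintegral_const, measure_univ, one_mul,
          lintegral_indicator (measurableSet_confused_right β b l j)]
        gcongr
        exact setLIntegral_confused_le hb hne hρ hρ4
    _ = _ := by rw [ENNReal.ofReal_add zero_le_one (by positivity), ENNReal.ofReal_one]

/-! ### Probability that a batch is regular -/

section Batch

variable {k p : ℕ} {w : Fin k → ℝ}

theorem isProbabilityMeasure_sampleLaw (p : ℕ) (hw : ∀ j, 0 ≤ w j) (hw1 : ∑ j, w j = 1) :
    IsProbabilityMeasure (sampleLaw p w) := by
  have := isProbabilityMeasure_labelLaw hw hw1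
  unfold sampleLaw; infer_instance

theorem lintegral_exp_labelEnergy_sampleLaw_le (hw : ∀ j, 0 ≤ w j) (hw1 : ∑ j, w j = 1)
    (j : Fin k) {v : Vec p} (hv : ‖v‖ = 1) :
    ∫⁻ q, ENNReal.ofReal (Real.exp (1 / 4 * labelEnergy j v q)) ∂(sampleLaw p w) ≤
      ENNReal.ofReal (Real.exp (w j)) := by
  refine lintegral_exp_sampleLaw_le hw hw1 (f := fun q => 1 / 4 * labelEnergy j v q)
    ((measurable_labelEnergy j v).const_mul _) (c := fun l => if l = j then 1 else 0)
    (fun l => by split_ifs <;> norm_num) (fun l => ?_) (by simp)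
  by_cases hl : l = j
  · simp only [labelEnergy, if_pos hl]
    exact (lintegral_exp_inner_sq_le_two hv.le le_rfl).trans_eq (by norm_num)
  · simp [labelEnergy, hl]

theorem lintegral_exp_clearEnergy_sampleLaw_le (hw : ∀ j, 0 ≤ w j) (hw1 : ∑ j, w j = 1)
    {β b : Fin k → Vec p} {ε ρ : ℝ} (hb : ∀ l, ‖b l - β l‖ ≤ ε) {j : Fin k}
    (hsep : ∀ m, m ≠ j → β j ≠ β m ∧ ε ≤ ρ * ‖β j - β m‖) (hρ0 : 0 ≤ ρ)
    (hρ : 64 * k * ρ ≤ 1) {v : Vec p} (hv : ‖v‖ = 1) :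
    ∫⁻ q, ENNReal.ofReal (Real.exp (-(3 / 2) * clearEnergy β b j v q)) ∂(sampleLaw p w) ≤
      ENNReal.ofReal (Real.exp (-(1 / 4) * w j)) := by
  have hm : Measurable fun q => -(3 / 2) * clearEnergy β b j v q :=
    ((measurable_clearEnergy β j v).comp (measurable_const.prodMk measurable_id)).const_mul _
  refine lintegral_exp_sampleLaw_le hw hw1 hm (c := fun l => if l = j then -(1 / 4) else 0)
    (fun l => by split_ifs <;> norm_num) (fun l => ?_) (by simp [mul_comm])
  by_cases hl : l = j
  · subst hl
    rw [if_pos rfl]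
    exact lintegral_exp_clearEnergy_le hb hsep hρ0 hρ hv
  · simp [clearEnergy, hl]

theorem lintegral_exp_confusionLoss_sampleLaw_le (hw : ∀ j, 0 ≤ w j) (hw1 : ∑ j, w j = 1)
    {β b : Fin k → Vec p} {ε ρ : ℝ} (hb : ∀ l, ‖b l - β l‖ ≤ ε) {j : Fin k}
    (hsep : ∀ m, m ≠ j → β m ≠ β j ∧ ε ≤ ρ * ‖β m - β j‖) (hρ0 : 0 ≤ ρ) (hρ : ρ ≤ 1 / 4) :
    ∫⁻ q, ENNReal.ofReal (Real.exp (1 / 64 * (ε⁻¹ ^ 2 * confusionLoss β b j q)))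
      ∂(sampleLaw p w) ≤ ENNReal.ofReal (Real.exp (16 * ρ)) := by
  have hm : Measurable fun q => 1 / 64 * (ε⁻¹ ^ 2 * confusionLoss β b j q) :=
    (((measurable_confusionLoss β j).comp
      (measurable_const.prodMk measurable_id)).const_mul _).const_mul _
  refine lintegral_exp_sampleLaw_le hw hw1 hm (c := fun _ => 16 * ρ) (fun l => by positivity)
    (fun l => ?_) (by rw [← Finset.sum_mul, hw1, one_mul])
  by_cases hl : l = j
  · subst hl
    simp [confusionLoss, hρ0]
  · exact lintegral_exp_confusionLoss_le hb (hsep l hl).1 (hsep l hl).2 hρ hρ0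

theorem exp_mul_le_of_card_le {N : Finset (Vec p)} {C a s : ℝ} {d : ℕ} (hC : 0 ≤ C)
    (hN : (N.card : ℝ) ≤ C ^ p) (hCd : C ≤ Real.exp d) (h : d * p + a ≤ s) :
    (N.card : ℝ≥0∞) * ENNReal.ofReal (Real.exp a) ≤ ENNReal.ofReal (Real.exp s) := by
  rw [← ENNReal.ofReal_natCast, ← ENNReal.ofReal_mul (by positivity)]
  refine ENNReal.ofReal_le_ofReal ?_
  calc (N.card : ℝ) * Real.exp a ≤ Real.exp d ^ p * Real.exp a := by
        gcongr; exact hN.trans (pow_le_pow_left₀ hC hCd p)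
    _ = Real.exp (d * p + a) := by rw [← Real.exp_nat_mul, ← Real.exp_add, mul_comm (p : ℝ)]
    _ ≤ _ := Real.exp_le_exp.2 h

/-- A batch fails to be regular with probability at most `3 exp (-3 p)`. -/
theorem pi_not_isRegularBatch_le (hw : ∀ j, 0 ≤ w j) (hw1 : ∑ j, w j = 1)
    {β b : Fin k → Vec p} {ε ρ : ℝ} (hb : ∀ l, ‖b l - β l‖ ≤ ε) {j : Fin k}
    (hsep : ∀ m, m ≠ j → β j ≠ β m ∧ ε ≤ ρ * ‖β j - β m‖) (hρ0 : 0 ≤ ρ)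
    (hρ : 64 * k * ρ ≤ 1) (hρw : 2 ^ 20 * ρ ≤ w j) {B : ℕ} (hB : 65536 * p ≤ B * w j)
    {N N' : Finset (Vec p)} (hN : ∀ v ∈ N, ‖v‖ = 1) (hNc : (N.card : ℝ) ≤ 5 ^ p)
    (hN' : ∀ v ∈ N', ‖v‖ = 1) (hNc' : (N'.card : ℝ) ≤ 129 ^ p) :
    (Measure.pi fun _ : Fin B => sampleLaw p w)
      {q | ¬ IsRegularBatch β b j (B * w j) ε N N' q} ≤
      3 * ENNReal.ofReal (Real.exp (-(3 * p))) := by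
  have := isProbabilityMeasure_sampleLaw p hw hw1
  set P := Measure.pi fun _ : Fin B => sampleLaw p w
  have hk : (1 : ℝ) ≤ k := by exact_mod_cast j.pos
  have hρ4 : ρ ≤ 1 / 4 := by nlinarith
  have hε : 0 ≤ ε := (norm_nonneg _).trans (hb j)
  have hp : (0 : ℝ) ≤ p := p.cast_nonneg
  have hW : 0 ≤ B * w j := mul_nonneg B.cast_nonneg (hw j)
  have h1 : P (⋃ v ∈ N, {q | 16 * (B * w j) / 4 ≤ ∑ i, 1 / 4 * labelEnergy j v (q i)}) ≤
      ENNReal.ofReal (Real.exp (-(3 * p))) := by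
    refine (measure_biUnion_finset_le _ _).trans ?_
    refine (Finset.sum_le_sum fun v hv => pi_measure_sum_ge_le (sampleLaw p w) B
      ((measurable_labelEnergy j v).const_mul (1 / 4)) _
      (lintegral_exp_labelEnergy_sampleLaw_le hw hw1 j (hN v hv))).trans ?_
    rw [Finset.sum_const, nsmul_eq_mul]
    -- With `W = B * w j` the total exponent is `2 p + W - 4 W`, where `5 ≤ e²` bounds the net.
    refine exp_mul_le_of_card_le (d := 2) (by norm_num) hNc ?_ (by push_cast; linarith)
    have h := Real.exp_one_gt_d9
    have e : Real.exp (2 : ℕ) = Real.exp 1 ^ 2 := by rw [← Real.exp_nat_mul]; norm_num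
    rw [e]
    nlinarith
  have h2 : P (⋃ v ∈ N', {q | -(3 / 2) * (B * w j / 16) ≤
      ∑ i, -(3 / 2) * clearEnergy β b j v (q i)}) ≤ ENNReal.ofReal (Real.exp (-(3 * p))) := by
    refine (measure_biUnion_finset_le _ _).trans ?_
    refine (Finset.sum_le_sum fun v hv => pi_measure_sum_ge_le (sampleLaw p w) B
      (f := fun q => -(3 / 2) * clearEnergy β b j v q)
      (((measurable_clearEnergy β j v).comp (measurable_const.prodMk measurable_id)).const_mul _) _
      (lintegral_exp_clearEnergy_sampleLaw_le hw hw1 hb hsep hρ0 hρ (hN' v hv))).trans ?_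
    rw [Finset.sum_const, nsmul_eq_mul]
    -- The total exponent is `5 p - W / 4 + 3 W / 32`, where `129 ≤ e⁵` bounds the net.
    refine exp_mul_le_of_card_le (d := 5) (by norm_num) hNc' ?_ (by push_cast; linarith)
    have h := Real.exp_one_gt_d9
    have e : Real.exp (5 : ℕ) = Real.exp 1 ^ 5 := by rw [← Real.exp_nat_mul]; norm_num
    rw [e]
    calc (129 : ℝ) ≤ 2.7 ^ 5 := by norm_num
      _ ≤ _ := by gcongr; linarith
  have h3 : P {q | 1 / 64 * (B * w j / 256) ≤
      ∑ i, 1 / 64 * (ε⁻¹ ^ 2 * confusionLoss β b j (q i))} ≤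
      ENNReal.ofReal (Real.exp (-(3 * p))) := by
    refine (pi_measure_sum_ge_le (sampleLaw p w) B
      (f := fun q => 1 / 64 * (ε⁻¹ ^ 2 * confusionLoss β b j q))
      ((((measurable_confusionLoss β j).comp
        (measurable_const.prodMk measurable_id)).const_mul _).const_mul _) _
      (lintegral_exp_confusionLoss_sampleLaw_le hw hw1 hb
        (fun m hm => ⟨(hsep m hm).1.symm, norm_sub_rev (β j) _ ▸ (hsep m hm).2⟩) hρ0 hρ4)).trans ?_
    refine ENNReal.ofReal_le_ofReal (Real.exp_le_exp.2 ?_)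
    -- So `16 ρ B ≤ W / 2¹⁶`, against the threshold `W / 2¹⁴`. The gap `3 W / 2¹⁶` is at least `3
    -- p`.
    have : (B : ℝ) * (2 ^ 20 * ρ) ≤ B * w j := by gcongr
    linarith
  have hsub : {q : Fin B → Vec p × Fin k | ¬ IsRegularBatch β b j (B * w j) ε N N' q} ⊆
      ((⋃ v ∈ N, {q | 16 * (B * w j) / 4 ≤ ∑ i, 1 / 4 * labelEnergy j v (q i)}) ∪
      (⋃ v ∈ N', {q | -(3 / 2) * (B * w j / 16) ≤
        ∑ i, -(3 / 2) * clearEnergy β b j v (q i)})) ∪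
      {q | 1 / 64 * (B * w j / 256) ≤
        ∑ i, 1 / 64 * (ε⁻¹ ^ 2 * confusionLoss β b j (q i))} := by
    intro q hq
    by_contra hcon
    simp only [Set.mem_union, Set.mem_iUnion, Set.mem_ofPred_eq, not_or, not_exists, not_le,
      ← Finset.mul_sum] at hcon
    obtain ⟨⟨c1, c2⟩, c3⟩ := hcon
    refine hq ⟨fun v hv => ?_, fun v hv => ?_, ?_⟩
    · linarith [c1 v hv]
    · linarith [c2 v hv]
    -- For `ε = 0` the scaled bound is void because `ε⁻¹ = 0`, but then `b = β` and the loss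
    -- vanishes.
    · rcases hε.eq_or_lt with h0 | h0
      · have hz : ∀ l, b l - β l = 0 := fun l => norm_le_zero_iff.1 ((hb l).trans_eq h0.symm)
        rw [Finset.sum_eq_zero fun i _ => by simp [confusionLoss, hz]]
        positivity
      · have h4 : ε⁻¹ ^ 2 * ∑ i, confusionLoss β b j (q i) ≤ B * w j / 256 := by linarith
        rw [inv_pow, inv_mul_le_iff₀ (by positivity)] at h4
        linarith
  calc P _ ≤ _ := measure_mono hsub
    _ ≤ ENNReal.ofReal (Real.exp (-(3 * p))) + ENNReal.ofReal (Real.exp (-(3 * p))) +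
        ENNReal.ofReal (Real.exp (-(3 * p))) :=
      (measure_union_le _ _).trans (add_le_add ((measure_union_le _ _).trans (add_le_add h1 h2)) h3)
    _ = _ := by ring

end Batch

/-! ### Independence of the iterate and the next batch -/

theorem measure_le_of_indepFun {Ω α γ : Type*} [MeasurableSpace Ω] [MeasurableSpace α]
    [MeasurableSpace γ] {μ : Measure Ω} [IsProbabilityMeasure μ] {X : Ω → α} {Y : Ω → γ}
    (hX : Measurable X) (hY : Measurable Y) (h : IndepFun X Y μ) {A : Set (α × γ)}
    (hA : MeasurableSet A) {K : ℝ≥0∞} (hK : ∀ a, (μ.map Y) (Prod.mk a ⁻¹' A) ≤ K) :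
    μ ((fun ω => (X ω, Y ω)) ⁻¹' A) ≤ K := by
  have : IsProbabilityMeasure (μ.map X) := Measure.isProbabilityMeasure_map hX.aemeasurable
  have : IsProbabilityMeasure (μ.map Y) := Measure.isProbabilityMeasure_map hY.aemeasurable
  rw [← Measure.map_apply (hX.prodMk hY) hA,
    h.map_prod_eq_prod_map_map hX.aemeasurable hY.aemeasurable, Measure.prod_apply hA]
  calc _ ≤ ∫⁻ _, K ∂(μ.map X) := lintegral_mono fun a => hK a
    _ = K := by rw [lintegral_const, measure_univ, mul_one]

theorem minWeight_le {k : ℕ} (w : Fin k → ℝ) (j : Fin k) : minWeight w ≤ w j :=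
  ciInf_le (Set.finite_range w).bddBelow j

theorem minWeight_pos {k : ℕ} {w : Fin k → ℝ} (hw : ∀ j, 0 < w j) (j : Fin k) :
    0 < minWeight w := by
  have : Nonempty (Fin k) := ⟨j⟩
  obtain ⟨i, hi⟩ := exists_eq_ciInf_of_finite (f := w)
  rw [minWeight, ← hi]; exact hw i

theorem le_mul_norm_sub_of_le_separation {k p : ℕ} {β : Fin k → Vec p} {ε ρ : ℝ} (hρ : 0 ≤ ρ)
    (h : ENNReal.ofReal ε ≤ ENNReal.ofReal ρ * separation β) {i j : Fin k} (hij : i ≠ j) :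
    ε ≤ ρ * ‖β i - β j‖ := by
  have h1 : separation β ≤ edist (β i) (β j) :=
    (iInf_le _ i).trans ((iInf_le _ j).trans (iInf_le _ hij))
  have h2 := h.trans (mul_le_mul_right h1 _)
  rw [edist_dist, ← ENNReal.ofReal_mul hρ, dist_eq_norm] at h2
  exact (ENNReal.ofReal_le_ofReal_iff (by positivity)).1 h2

section Sample

variable {Ω : Type*} [MeasurableSpace Ω] {μ : Measure Ω} {k p n T B : ℕ}
  {w : Fin k → ℝ} {β : Fin k → Vec p} {x : Fin n → Ω → Vec p} {c : Fin n → Ω → Fin k}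
  {y : Fin n → Ω → ℝ}

theorem IsMixedLinearSample.response_eq (h : IsMixedLinearSample μ w β x c y) (i : Fin n) (ω : Ω) :
    y i ω = inner ℝ (x i ω) (β (c i ω)) := by
  rw [h.response]; simp

theorem IsMixedLinearSample.measurable_pair (h : IsMixedLinearSample μ w β x c y) (i : Fin n) :
    Measurable fun ω => (x i ω, c i ω) :=
  (h.measurable_covariate i).prodMk (h.measurable_label i)

theorem IsMixedLinearSample.map_pair [IsProbabilityMeasure μ]
    (h : IsMixedLinearSample μ w β x c y) (i : Fin n) :
    μ.map (fun ω => (x i ω, c i ω)) = sampleLaw p w := by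
  rw [(h.indep_covariate_label i).map_prod_eq_prod_map_map (h.measurable_covariate i).aemeasurable
    (h.measurable_label i).aemeasurable, h.law_covariate, sampleLaw]
  congr 1
  refine eq_labelLaw fun j => ?_
  rw [Measure.map_apply (h.measurable_label i) (measurableSet_singleton j)]
  exact h.law_label i j

theorem IsMixedLinearSample.map_batch [IsProbabilityMeasure μ]
    (h : IsMixedLinearSample μ w β x c y)
    (e : Fin T × Fin B ≃ Fin n) (t : Fin T) :
    μ.map (fun ω (i : Fin B) => (x (e (t, i)) ω, c (e (t, i)) ω)) =
      Measure.pi fun _ => sampleLaw p w := by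
  have hi : iIndepFun (fun (i : Fin B) ω => (x (e (t, i)) ω, c (e (t, i)) ω)) μ :=
    h.indep_samples.precomp (g := fun i => e (t, i)) fun i i' hii => by simpa using hii
  rw [hi.map_fun_eq_pi_map fun i => (h.measurable_pair _).aemeasurable]
  simp_rw [h.map_pair]

/-- The iterate `t` is measurable and independent of the batch `t`. -/
theorem IsResampledAltMin.indepFun_batch [IsProbabilityMeasure μ]
    (h : IsMixedLinearSample μ w β x c y)
    {e : Fin T × Fin B ≃ Fin n} {b₀ : Fin k → Vec p} {b : ℕ → Ω → Fin k → Vec p}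
    (hA : IsResampledAltMin x y e b₀ b) (t : Fin T) :
    Measurable (b t) ∧
      IndepFun (b t) (fun ω (i : Fin B) => (x (e (t, i)) ω, c (e (t, i)) ω)) μ := by
  classical
  obtain ⟨g, hg, hbg⟩ := hA.adapted t t.2.le
  set f : Fin n → Ω → Vec p × Fin k := fun i ω => (x i ω, c i ω)
  let S : Finset (Fin n) := Finset.univ.filter fun i => (e.symm i).1 < t
  let S' : Finset (Fin n) := Finset.univ.filter fun i => (e.symm i).1 = t
  have hSS : Disjoint S S' := Finset.disjoint_filter.2 fun i _ h1 h2 => h1.ne h2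
  have hind := h.indep_samples.indepFun_finset S S' hSS h.measurable_pair
  have hresp : Measurable fun q : Vec p × Fin k => (q.1, (inner ℝ q.1 (β q.2) : ℝ)) :=
    measurable_fst.prodMk (measurable_from_prod_countable_left fun l => by fun_prop)
  -- The responses are functions of covariate and label, so the iterate is a function of the pairs
  -- in earlier batches, which are independent of those in batch `t`.
  let G : (S → Vec p × Fin k) → Fin k → Vec p := fun u => g fun q =>
    ((u ⟨e (q.1.1, q.2), by simpa [S] using q.1.2⟩).1,
      inner ℝ (u ⟨e (q.1.1, q.2), by simpa [S] using q.1.2⟩).1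
        (β (u ⟨e (q.1.1, q.2), by simpa [S] using q.1.2⟩).2))
  have hG : Measurable G := hg.comp (measurable_pi_lambda _ fun q =>
    hresp.comp (measurable_pi_apply _))
  have hb : b t = G ∘ fun ω (i : S) => f i ω := by
    funext ω
    rw [hbg ω]
    simp only [G, f, Function.comp_apply, h.response_eq]
  let G' : (S' → Vec p × Fin k) → Fin B → Vec p × Fin k := fun u i =>
    u ⟨e (t, i), by simp [S']⟩
  have hG' : Measurable G' := measurable_pi_lambda _ fun i => measurable_pi_apply _
  rw [hb]
  exact ⟨hG.comp (measurable_pi_lambda _ fun i => h.measurable_pair _), hind.comp hG hG'⟩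

theorem IsResampledAltMin.measure_not_isRegularBatch_le [IsProbabilityMeasure μ]
    (h : IsMixedLinearSample μ w β x c y)
    {e : Fin T × Fin B ≃ Fin n} {b₀ : Fin k → Vec p} {b : ℕ → Ω → Fin k → Vec p}
    (hA : IsResampledAltMin x y e b₀ b) (hw : ∀ j, 0 ≤ w j) (hw1 : ∑ j, w j = 1)
    (π : Equiv.Perm (Fin k)) (t : Fin T) {ε ρ : ℝ} {j : Fin k}
    (hsep : ∀ m, m ≠ j → β j ≠ β m ∧ ε ≤ ρ * ‖β j - β m‖) (hρ0 : 0 ≤ ρ)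
    (hρ : 64 * k * ρ ≤ 1) (hρw : 2 ^ 20 * ρ ≤ w j) (hB : 65536 * p ≤ B * w j)
    {N N' : Finset (Vec p)} (hN : ∀ v ∈ N, ‖v‖ = 1) (hNc : (N.card : ℝ) ≤ 5 ^ p)
    (hN' : ∀ v ∈ N', ‖v‖ = 1) (hNc' : (N'.card : ℝ) ≤ 129 ^ p) :
    μ {ω | (∀ l, ‖b t ω (π.symm l) - β l‖ ≤ ε) ∧
      ¬ IsRegularBatch β (fun l => b t ω (π.symm l)) j (B * w j) ε N N'
        (fun i => (x (e (t, i)) ω, c (e (t, i)) ω))} ≤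
      3 * ENNReal.ofReal (Real.exp (-(3 * p))) := by
  obtain ⟨hbm, hbi⟩ := hA.indepFun_batch h t
  have hperm : Measurable fun (u : Fin k → Vec p) l => u (π.symm l) :=
    measurable_pi_lambda _ fun l => measurable_pi_apply _
  have hYm : Measurable fun ω (i : Fin B) => (x (e (t, i)) ω, c (e (t, i)) ω) :=
    measurable_pi_lambda _ fun i => h.measurable_pair _
  let A : Set ((Fin k → Vec p) × (Fin B → Vec p × Fin k)) :=
    (⋂ l, {r | ‖r.1 l - β l‖ ≤ ε}) ∩ {r | IsRegularBatch β r.1 j (B * w j) ε N N' r.2}ᶜ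
  have hAm : MeasurableSet A :=
    (MeasurableSet.iInter fun l => measurableSet_le (by fun_prop) (by fun_prop)).inter
      (measurableSet_isRegularBatch β j _ ε N N').compl
  refine le_trans (measure_mono fun ω hω => ?_) (measure_le_of_indepFun (hperm.comp hbm) hYm
    (hbi.comp hperm measurable_id) hAm fun u => ?_)
  · simpa [A] using hω
  · rw [h.map_batch e t]
    -- The error bound is part of the event, so the slice over estimates that violate it is empty.
    by_cases hu : ∀ l, ‖u l - β l‖ ≤ ε
    · refine (measure_mono fun q hq => ?_).trans
        (pi_not_isRegularBatch_le hw hw1 hu hsep hρ0 hρ hρw hB hN hNc hN' hNc')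
      exact hq.2
    · rw [show Prod.mk u ⁻¹' A = ∅ from Set.eq_empty_of_forall_notMem fun q hq =>
        hu fun l => Set.mem_iInter.1 hq.1 l, measure_empty]
      exact zero_le

end Sample

/-! ### Union bound and the main theorem -/

theorem mul_three_mul_exp_le {k p T : ℕ} {δ : ℝ} (hδ : 0 < δ) (hk : 1 ≤ k) (hp : 1 ≤ p)
    (hT : 0 < T) (h : Real.log (2 * (k : ℝ) ^ 2 * T / δ) ≤ p) :
    (T : ℝ) * (k * (3 * Real.exp (-(3 * p)))) ≤ δ := by
  have hk' : (1 : ℝ) ≤ k := by exact_mod_cast hk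
  have hp' : (1 : ℝ) ≤ p := by exact_mod_cast hp
  have hT' : (0 : ℝ) < T := by exact_mod_cast hT
  have h1 : 2 * (k : ℝ) ^ 2 * T / δ ≤ Real.exp p := (Real.log_le_iff_le_exp (by positivity)).1 h
  rw [div_le_iff₀ hδ] at h1
  have h2 : 3 * Real.exp (-(3 * p)) ≤ Real.exp (-p) := by
    have e : Real.exp (-(p : ℝ)) = Real.exp (2 * p) * Real.exp (-(3 * p)) := by
      rw [← Real.exp_add]; congr 1; ring
    rw [e]
    gcongr
    linarith [Real.add_one_le_exp (2 * (p : ℝ))]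
  calc (T : ℝ) * (k * (3 * Real.exp (-(3 * p)))) ≤ T * (k * Real.exp (-p)) := by gcongr
    _ ≤ 2 * k ^ 2 * T * Real.exp (-p) := by
        rw [← mul_assoc, mul_comm (T : ℝ)]
        gcongr
        nlinarith
    _ ≤ Real.exp p * δ * Real.exp (-p) := mul_le_mul_of_nonneg_right h1 (Real.exp_pos _).le
    _ = δ := by rw [mul_right_comm, ← Real.exp_add]; simp

end MixedLinear

theorem theorem2 :
    ∃ C₁ : ℝ, 0 < C₁ ∧ ∃ C₂ : ℝ, 0 < C₂ ∧
      ∀ (k p n T B : ℕ) (δ : ℝ), 0 < δ → δ < 1 → 0 < T →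
      -- the parameters and the weights
      ∀ (w : Fin k → ℝ) (β : Fin k → MixedLinear.Vec p),
        (∀ j, 0 < w j) → ∑ j, w j = 1 → LinearIndependent ℝ β →
      -- the samples
      ∀ {Ω : Type*} [MeasurableSpace Ω] (μ : Measure Ω) [IsProbabilityMeasure μ]
        (x : Fin n → Ω → MixedLinear.Vec p) (c : Fin n → Ω → Fin k) (y : Fin n → Ω → ℝ),
        MixedLinear.IsMixedLinearSample μ w β x c y →
      -- the iterates on the samples, split into `T` batches of size `B`
      ∀ (e : Fin T × Fin B ≃ Fin n) (b₀ : Fin k → MixedLinear.Vec p)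
        (b : ℕ → Ω → Fin k → MixedLinear.Vec p),
        MixedLinear.IsResampledAltMin x y e b₀ b →
      -- the conditions on the initial error, the dimension and the batch size
        ENNReal.ofReal (MixedLinear.estimationError b₀ β) ≤
            ENNReal.ofReal (C₁ * min (1 / (k : ℝ) ^ 2) (MixedLinear.minWeight w)) *
              MixedLinear.separation β →
        Real.log (2 * (k : ℝ) ^ 2 * T / δ) ≤ p →
        C₂ * max ((k : ℝ) * p / MixedLinear.minWeight w)
            (Real.log (8 * (k : ℝ) ^ 2 * T / δ) / MixedLinear.minWeight w ^ 2) ≤ (n : ℝ) / T →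
        1 - δ ≤ μ.real {ω | ∀ t : ℕ, 1 ≤ t → t ≤ T →
          MixedLinear.estimationError (b t ω) β ≤
            (1 / 2) ^ t * MixedLinear.estimationError b₀ β} := by
  refine ⟨1 / 2 ^ 20, by positivity, 65536, by positivity, ?_⟩
  intro k p n T B δ hδ0 _ hT w β hw hw1 hβ Ω _ μ _ x c y hS e b₀ b hA hinit hp hn
  have hw0 : ∀ j, 0 ≤ w j := fun j => (hw j).le
  have hk : 0 < k := by
    rcases Nat.eq_zero_or_pos k with rfl | hk
    · simp at hw1
    · exact hk
  have hk1 : (1 : ℝ) ≤ k := by exact_mod_cast hk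
  have hp1 : 1 ≤ p := by
    rcases Nat.eq_zero_or_pos p with rfl | hp
    · exact absurd (Subsingleton.elim _ _) (hβ.ne_zero ⟨0, hk⟩)
    · exact hp
  have hω := MixedLinear.minWeight_pos hw ⟨0, hk⟩
  set ω₀ := MixedLinear.minWeight w
  set ε₀ := MixedLinear.estimationError b₀ β with hε₀
  have hε0 : 0 ≤ ε₀ := MixedLinear.estimationError_nonneg b₀ β
  set ρ : ℝ := 1 / 2 ^ 20 * min (1 / (k : ℝ) ^ 2) ω₀ with hρdef
  have hρ0 : 0 ≤ ρ := by positivity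
  have hρk : 64 * k * ρ ≤ 1 := by
    have h1 : k * min (1 / (k : ℝ) ^ 2) ω₀ ≤ 1 := by
      calc k * min (1 / (k : ℝ) ^ 2) ω₀ ≤ k * (1 / (k : ℝ) ^ 2) := by
            gcongr; exact min_le_left _ _
        _ = 1 / k := by field_simp
        _ ≤ 1 := by rw [div_le_one (by positivity)]; exact hk1
    rw [hρdef]
    linarith
  have hρw : ∀ j, 2 ^ 20 * ρ ≤ w j := fun j => by
    rw [hρdef, ← mul_assoc, mul_one_div_cancel (by positivity), one_mul]
    exact (min_le_right _ _).trans (MixedLinear.minWeight_le w j)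
  have hnB : (n : ℝ) / T = B := by
    have hcard : T * B = n := by simpa using Fintype.card_congr e
    rw [← hcard]; push_cast; field_simp
  have hB : ∀ j, 65536 * (p : ℝ) ≤ B * w j := fun j => by
    have h1 : 65536 * ((k : ℝ) * p / ω₀) ≤ B := by
      rw [← hnB]; exact le_trans (by gcongr; exact le_max_left _ _) hn
    have h2 : 65536 * ((k : ℝ) * p / ω₀) * ω₀ ≤ B * w j := by
      gcongr; exact MixedLinear.minWeight_le w j
    have h3 : 65536 * ((k : ℝ) * p / ω₀) * ω₀ = 65536 * (k * p) := by field_simp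
    rw [h3] at h2
    have h4 : (p : ℝ) ≤ k * p := le_mul_of_one_le_left p.cast_nonneg hk1
    linarith
  have hsep : ∀ (t : ℕ) (j m : Fin k), m ≠ j →
      β j ≠ β m ∧ (1 / 2) ^ t * ε₀ ≤ ρ * ‖β j - β m‖ := fun t j m hmj =>
    ⟨fun h => hmj (hβ.injective h).symm, (mul_le_of_le_one_left hε0
      (pow_le_one₀ (by norm_num) (by norm_num))).trans
      (MixedLinear.le_mul_norm_sub_of_le_separation hρ0 hinit hmj.symm)⟩
  obtain ⟨π, hπ⟩ := MixedLinear.exists_perm_norm_sub_le b₀ β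
  obtain ⟨N, hNc, hN1, hN⟩ := MixedLinear.exists_net p (η := 1 / 2) (by norm_num)
  obtain ⟨N', hNc', hN1', hN'⟩ := MixedLinear.exists_net p (η := 1 / 64) (by norm_num)
  -- The bases `1 + 2 / η` become `5` and `129`.
  norm_num at hNc hNc'
  -- An event is bad only if the error bound still holds before iteration `t`. Off all bad events
  -- the bound therefore propagates by a deterministic induction, without conditioning.
  let bad : Fin T → Fin k → Set Ω := fun t j =>
    {ω | (∀ l, ‖b t ω (π.symm l) - β l‖ ≤ (1 / 2) ^ (t : ℕ) * ε₀) ∧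
      ¬ MixedLinear.IsRegularBatch β (fun l => b t ω (π.symm l)) j (B * w j)
        ((1 / 2) ^ (t : ℕ) * ε₀) N N' (fun i => (x (e (t, i)) ω, c (e (t, i)) ω))}
  have hbad : μ (⋃ t, ⋃ j, bad t j) ≤ ENNReal.ofReal δ := by
    calc μ (⋃ t, ⋃ j, bad t j) ≤ ∑ t, ∑ j, μ (bad t j) :=
          (measure_iUnion_fintype_le _ _).trans
            (Finset.sum_le_sum fun t _ => measure_iUnion_fintype_le _ _)
      _ ≤ ∑ _t : Fin T, ∑ _j : Fin k, 3 * ENNReal.ofReal (Real.exp (-(3 * p))) := by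
          refine Finset.sum_le_sum fun t _ => Finset.sum_le_sum fun j _ => ?_
          exact hA.measure_not_isRegularBatch_le hS hw0 hw1 π t (hsep t j) hρ0 hρk (hρw j) (hB j)
            hN1 hNc hN1' hNc'
      _ = ENNReal.ofReal (T * (k * (3 * Real.exp (-(3 * p))))) := by
          rw [ENNReal.ofReal_mul (by positivity), ENNReal.ofReal_mul (by positivity),
            ENNReal.ofReal_mul (by positivity)]
          simp
      _ ≤ ENNReal.ofReal δ :=
          ENNReal.ofReal_le_ofReal (MixedLinear.mul_three_mul_exp_le hδ0 hk hp1 hT hp)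
  have hgood : (⋃ t, ⋃ j, bad t j)ᶜ ⊆ {ω | ∀ t : ℕ, 1 ≤ t → t ≤ T →
      MixedLinear.estimationError (b t ω) β ≤ (1 / 2) ^ t * ε₀} := by
    intro ω hω'
    simp only [Set.mem_compl_iff, Set.mem_iUnion, not_exists] at hω'
    have hind : ∀ t : ℕ, t ≤ T → ∀ l, ‖b t ω (π.symm l) - β l‖ ≤ (1 / 2) ^ t * ε₀ := by
      intro t
      induction t with
      | zero =>
        intro _ l
        rw [hA.init, pow_zero, one_mul]
        exact hπ l
      | succ t ih =>
        intro ht l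
        have hprev := ih (Nat.le_of_succ_le ht)
        have hreg := not_not.1 fun hr => hω' ⟨t, ht⟩ l ⟨hprev, hr⟩
        obtain ⟨z, hz, hup⟩ := hA.step ⟨t, ht⟩ ω
        have h1 := hreg.norm_sub_le hN hN' (lt_of_lt_of_le (by positivity) (hB l))
          (by positivity) (fun i => hS.response_eq (e (⟨t, ht⟩, i)) ω) (hz.perm π) (hup.perm π)
        rw [pow_succ]
        linarith
    exact fun t _ ht => MixedLinear.estimationError_le (by positivity) π (hind t ht)
  refine le_trans ?_ (measureReal_mono hgood)
  -- Subadditivity suffices here, so the bad events need not be shown measurable.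
  have h1 : (1 : ℝ) ≤ μ.real (⋃ t, ⋃ j, bad t j) + μ.real (⋃ t, ⋃ j, bad t j)ᶜ := by
    have := measureReal_union_le (μ := μ) (⋃ t, ⋃ j, bad t j) (⋃ t, ⋃ j, bad t j)ᶜ
    rwa [Set.union_compl_self, probReal_univ] at this
  have h2 : μ.real (⋃ t, ⋃ j, bad t j) ≤ δ := ENNReal.toReal_le_of_le_ofReal hδ0.le hbad
  linarith
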